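/- Let $0<\alpha\le 1$, $0<\beta\le 1$ with $\alpha+\beta\neq 2$. A source broadcasts to $n$ users over independent, identically distributed, time-slotted erasure channels. The channel $C_i[t]\in\{0,1\}$ ($1$ = ON, $0$ = OFF) of user $i$ is a two-state Markov chain with $P(\mathrm{ON}\to\mathrm{OFF})=\alpha$ and $P(\mathrm{OFF}\to\mathrm{ON})=\beta$, and all channels are ON in slot $0$. Let $p=\frac{\alpha}{\alpha+\beta}$ be the steady-state erasure probability. Under random linear network coding (RLNC) with block size $k\ge 1$, the source sends one coded packet per slot, in slots $1,2,\dots$; user $i$ receives the packet of slot $t$ if and only if $C_i[t]=1$; the current block of $k$ data packets is completed at the end of the first slot by which every user has received at least $k$ coded packets of that block, and the next block starts in the following slot. Let $R[t]$ be $k$ times the number of blocks completed in the slots $1,\dots,t$. Then for all $n,k\ge 1$ the limit $\eta(n,k)=\lim_{t\to\infty}R[t]/t$ exists almost surely and is a constant (the broadcast throughput), and for every sequence of block sizes $k=k(n)\ge 1$: 1. If $\beta<1$ and $k=o(\ln n)$, then $\lim_{n\to\infty}\eta(n,k)=0$. 2. If $k=\omega(\ln n)$, i.e. $k/\ln n\to\infty$,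 then $\lim_{n\to\infty}\eta(n,k)=1-p$. 3. If $k=\Theta(\ln n)$, then $\liminf_{n\to\infty}\eta(n,k)\ge r(1-p)$ with a constant $0<r<1$. More precisely, let $0<\hat b\le\liminf_{n\to\infty}k/\ln n$, let $\tau_0>0$ satisfy $e^{\tau_0}(1-\beta)<1$, and let $b>0$ be such that $\theta=\frac{b\beta}{\sqrt{\hat b\,\alpha(2-\alpha-\beta)}}$ satisfies $e^{\theta}(1-\beta)<1$. Then these two claims hold for $$r=\left(1+\frac{1-p}{\tau_0\hat b}+\frac{(1-p)\sqrt{\alpha(2-\alpha-\beta)}}{b\beta\sqrt{\hat b}}\bigl(1+\hat b\ln\rho\bigr)\right)^{-1},\qquad \rho=\frac{\exp\!\left(-\frac{b\sqrt{\alpha}}{\sqrt{\hat b(2-\alpha-\beta)}}\right)\left[1-\alpha(1-e^{\theta})-(1-\beta)e^{\theta}\right]}{1-(1-\beta)e^{\theta}}.$$ -/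

import Mathlib

open MeasureTheory ProbabilityTheory Filter Topology Asymptotics

/-- One-step transition probabilities of the two-state erasure channel. The state `true` is ON
(a transmission succeeds), `false` is OFF (it is erased); `α` is the probability of going from ON
to OFF and `β` the probability of going from OFF to ON. -/
def channelTransition (α β : ℝ) : Bool → Bool → ℝ
  | true, true => 1 - α
  | true, false => α
  | false, true => β
  | false, false => 1 - β

/-- Steady-state probability of an erasure. -/
noncomputable def erasureProb (α β : ℝ) : ℝ := α / (α + β)

/-- `C i t ω` is the state of the channel of user `i` in slot `t`. The channels of the `n` users
are independent, all of them are ON in slot `0`, and each of them is a Markov chain with the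
transition probabilities `channelTransition α β`. -/
structure IsErasureChannelSystem (α β : ℝ) {n : ℕ} {Ω : Type*} [MeasurableSpace Ω]
    (P : Measure Ω) (C : Fin n → ℕ → Ω → Bool) : Prop where
  measurable : ∀ i t, Measurable (C i t)
  start_on : ∀ i, ∀ᵐ ω ∂P, C i 0 ω = true
  markov : ∀ (i : Fin n) (t : ℕ) (c : ℕ → Bool),
    P.real {ω | ∀ s ≤ t + 1, C i s ω = c s} =
      P.real {ω | ∀ s ≤ t, C i s ω = c s} * channelTransition α β (c t) (c (t + 1))
  indep : iIndepFun (fun (i : Fin n) (ω : Ω) (t : ℕ) => C i t ω) P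

/-- Block transmission with block size `k` along the channel states `c`, after the slots
`1, …, t`: the number of blocks completed so far, and for each user the number of coded packets
of the current block it has received. A block is completed in the first slot at whose end every
user has received at least `k` coded packets of it; the next block starts in the next slot. -/
def rlncState {n : ℕ} (c : Fin n → ℕ → Bool) (k : ℕ) : ℕ → ℕ × (Fin n → ℕ)
  | 0 => (0, fun _ => 0)
  | t + 1 =>
    let s := rlncState c k t
    let received : Fin n → ℕ := fun i => s.2 i + if c i (t + 1) then 1 else 0
    if ∀ i, k ≤ received i then (s.1 + 1, fun _ => 0) else (s.1, received)

/-- Number of data packets transferred to all users in the slots `1, …, t`. -/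
def packetsTransferred {n : ℕ} (c : Fin n → ℕ → Bool) (k t : ℕ) : ℕ :=
  k * (rlncState c k t).1

/-- `x` is the broadcast throughput: almost surely the long-term average number of packets
transferred to all users per slot converges to `x`. -/
def IsThroughput {n : ℕ} {Ω : Type*} [MeasurableSpace Ω] (P : Measure Ω)
    (C : Fin n → ℕ → Ω → Bool) (k : ℕ) (x : ℝ) : Prop :=
  ∀ᵐ ω ∂P, Tendsto
    (fun t : ℕ => (packetsTransferred (fun i s => C i s ω) k t : ℝ) / (t : ℝ)) atTop (𝓝 x)

/-- The exponent `b * β / √(bhat * α * (2 - α - β))`. -/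
noncomputable def tiltExponent (α β bhat b : ℝ) : ℝ :=
  b * β / Real.sqrt (α * (2 - α - β)) / Real.sqrt bhat

/-- With `θ = tiltExponent α β bhat b`, this is `E[exp (θ (X - E[X]))]`, where `X` is the time
between two successive successful transmissions over one channel. -/
noncomputable def tiltedMoment (α β bhat b : ℝ) : ℝ :=
  Real.exp (-(b * Real.sqrt α) / Real.sqrt (2 - α - β) / Real.sqrt bhat) *
      (1 - α * (1 - Real.exp (tiltExponent α β bhat b)) -
        Real.exp (tiltExponent α β bhat b) * (1 - β)) /
    (1 - Real.exp (tiltExponent α β bhat b) * (1 - β))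

/-- The guaranteed fraction `r` of the capacity when the block size is at least asymptotically
`bhat * log n`; `b` and `τ₀` are free parameters. -/
noncomputable def capacityFraction (α β bhat b τ₀ : ℝ) : ℝ :=
  (1 + (1 - erasureProb α β) / (τ₀ * bhat) +
    (1 - erasureProb α β) * Real.sqrt (α * (2 - α - β)) / (b * β * Real.sqrt bhat) *
      (1 + bhat * Real.log (tiltedMoment α β bhat b)))⁻¹

/-! Channel states together with the block state form a Markov chain; let `T` be its one-slot
expectation operator. Since block progress is monotone, a state with `m` finished blocks lies
between a fresh start with `m` and one with `m + 1`. Hence the expected number `E t` of blocks in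
`t` slots is additive up to bounded errors, once a Doeblin minorization bounds the influence of the
initial channel states. Fekete's lemma gives `E t / t → g`, a variance bound linear in `t` makes the
convergence almost sure, and `η(n, k) = k * g`.

Three bounds on `g` then give the asymptotics. Capacity: the packets credited to one user, plus a
corrector depending on its channel state, have drift at most `1 - p`, so `k * g ≤ 1 - p`. Silence:
within `L` slots some user hears nothing, except with probability at most `exp (-n α (1-β)^L)`. With
`L` of order `log n`, this forces `η → 0` when `k = o(log n)`. Exponential weights
(`le_expectedBlocks_of_weight`): let `z` be the moment generating function at `θ` of the
interarrival time. Give a user with `r` packets the weight `z⁻¹ ^ r * w`, where `w` is an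
eigenvector, with eigenvalue `exp (-θ)`, of the tilted channel matrix. The logarithm of the total
weight loses at least `θ` per slot on average, and a completion raises it by at most `log n + k log
z + c`. So `θ ≤ (log n + k log z + c) * g`.

For `k = ω(log n)`, let `θ → 0`, where `log z / θ → 1 / (1 - p)`. For `k = Θ(log n)`, take `θ =
tiltExponent α β bhat b`; the `τ₀` term in `r` is slack that absorbs lower-order terms. -/

/-- The admissible transition probabilities of the erasure channel. -/
structure IsChannelParam (α β : ℝ) : Prop where
  pos_left : 0 < α
  left_le_one : α ≤ 1
  pos_right : 0 < β
  right_le_one : β ≤ 1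
  ne_two : α + β ≠ 2

/-! ### The Markov chain of broadcast states and its expectation operator -/

/-- The channel states of all users, together with the state of the block transmission. -/
abbrev BroadcastState (n : ℕ) := (Fin n → Bool) × (ℕ × (Fin n → ℕ))

/-- The packet counts after a slot with channel states `a`, before a completed block is cleared. -/
def receivedCount {n : ℕ} (r : Fin n → ℕ) (a : Fin n → Bool) (i : Fin n) : ℕ :=
  r i + if a i then 1 else 0

/-- One slot of the block transmission, with channel states `a`. -/
def rlncUpdate {n : ℕ} (k : ℕ) (s : ℕ × (Fin n → ℕ)) (a : Fin n → Bool) : ℕ × (Fin n → ℕ) :=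
  if ∀ i, k ≤ receivedCount s.2 a i then (s.1 + 1, fun _ => 0) else (s.1, receivedCount s.2 a)

theorem rlncState_succ {n : ℕ} (c : Fin n → ℕ → Bool) (k t : ℕ) :
    rlncState c k (t + 1) = rlncUpdate k (rlncState c k t) (fun i => c i (t + 1)) := rfl

theorem rlncUpdate_of_complete {n k : ℕ} {s : ℕ × (Fin n → ℕ)} {a : Fin n → Bool}
    (h : ∀ i, k ≤ receivedCount s.2 a i) : rlncUpdate k s a = (s.1 + 1, fun _ => 0) := if_pos h

theorem rlncUpdate_of_not_complete {n k : ℕ} {s : ℕ × (Fin n → ℕ)} {a : Fin n → Bool}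
    (h : ¬ ∀ i, k ≤ receivedCount s.2 a i) :
    rlncUpdate k s a = (s.1, receivedCount s.2 a) := if_neg h

theorem le_rlncUpdate_fst {n : ℕ} (k : ℕ) (s : ℕ × (Fin n → ℕ)) (a : Fin n → Bool) :
    s.1 ≤ (rlncUpdate k s a).1 := by
  unfold rlncUpdate; split_ifs <;> simp

theorem rlncUpdate_fst_le {n : ℕ} (k : ℕ) (s : ℕ × (Fin n → ℕ)) (a : Fin n → Bool) :
    (rlncUpdate k s a).1 ≤ s.1 + 1 := by
  unfold rlncUpdate; split_ifs <;> simp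

/-- Transition probabilities of the channels of all users. -/
def jointTransition (α β : ℝ) {n : ℕ} (c a : Fin n → Bool) : ℝ :=
  ∏ i, channelTransition α β (c i) (a i)

theorem channelTransition_nonneg {α β : ℝ} (h : IsChannelParam α β) (x y : Bool) :
    0 ≤ channelTransition α β x y := by
  obtain ⟨h1, h2, h3, h4, -⟩ := h
  cases x <;> cases y <;> simp [channelTransition] <;> linarith

theorem sum_channelTransition (α β : ℝ) (x : Bool) : ∑ y, channelTransition α β x y = 1 := by
  cases x <;> simp [channelTransition]

theorem jointTransition_nonneg {α β : ℝ} (h : IsChannelParam α β) {n : ℕ} (c a : Fin n → Bool) :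
    0 ≤ jointTransition α β c a :=
  Finset.prod_nonneg fun _ _ => channelTransition_nonneg h _ _

theorem sum_jointTransition_mul_prod (α β : ℝ) {n : ℕ} (c : Fin n → Bool)
    (f : Fin n → Bool → ℝ) :
    ∑ a, jointTransition α β c a * ∏ i, f i (a i) =
      ∏ i, ∑ b, channelTransition α β (c i) b * f i b := by
  rw [Finset.prod_univ_sum]
  simp only [Fintype.piFinset_univ, jointTransition, Finset.prod_mul_distrib]

theorem sum_jointTransition (α β : ℝ) {n : ℕ} (c : Fin n → Bool) :
    ∑ a, jointTransition α β c a = 1 := by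
  have := sum_jointTransition_mul_prod α β c (fun _ _ => 1)
  simpa only [mul_one, Finset.prod_const_one, sum_channelTransition] using this

theorem sum_jointTransition_mul_apply (α β : ℝ) {n : ℕ} (c : Fin n → Bool) (i : Fin n)
    (f : Bool → ℝ) :
    ∑ a, jointTransition α β c a * f (a i) = ∑ b, channelTransition α β (c i) b * f b := by
  have := sum_jointTransition_mul_prod α β c (fun j b => if j = i then f b else 1)
  simp only [Finset.prod_ite_eq', Finset.mem_univ, if_true] at this
  rw [this, Finset.prod_eq_single i]
  · simp
  · intro j _ hj
    simp only [hj, if_false, mul_one, sum_channelTransition]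
  · simp

/-- The one-slot expectation operator of the Markov chain of broadcast states. -/
noncomputable def stepOp (α β : ℝ) {n : ℕ} (k : ℕ) :
    Module.End ℝ (BroadcastState n → ℝ) where
  toFun F x := ∑ a, jointTransition α β x.1 a * F (a, rlncUpdate k x.2 a)
  map_add' F G := by
    funext x; simp [mul_add, Finset.sum_add_distrib]
  map_smul' r F := by
    funext x
    simp only [Pi.smul_apply, smul_eq_mul, RingHom.id_apply, Finset.mul_sum]
    exact Finset.sum_congr rfl fun _ _ => by ring

section stepOp

variable {α β : ℝ} {n k : ℕ}

theorem stepOp_apply (F : BroadcastState n → ℝ) (x : BroadcastState n) :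
    stepOp α β k F x = ∑ a, jointTransition α β x.1 a * F (a, rlncUpdate k x.2 a) := rfl

theorem stepOp_pow_succ (F : BroadcastState n → ℝ) (t : ℕ) :
    (stepOp α β k ^ (t + 1)) F = stepOp α β k ((stepOp α β k ^ t) F) := by
  rw [pow_succ']; rfl

theorem stepOp_pow_add (F : BroadcastState n → ℝ) (s t : ℕ) :
    (stepOp α β k ^ (s + t)) F = (stepOp α β k ^ s) ((stepOp α β k ^ t) F) := by
  rw [pow_add]; rfl

theorem stepOp_le (h : IsChannelParam α β) {F G : BroadcastState n → ℝ} {x : BroadcastState n}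
    (hFG : ∀ a, F (a, rlncUpdate k x.2 a) ≤ G (a, rlncUpdate k x.2 a)) :
    stepOp α β k F x ≤ stepOp α β k G x :=
  Finset.sum_le_sum fun a _ => mul_le_mul_of_nonneg_left (hFG a) (jointTransition_nonneg h _ _)

theorem stepOp_const (r : ℝ) : stepOp α β k (fun _ : BroadcastState n => r) = fun _ => r := by
  funext x
  rw [stepOp_apply, ← Finset.sum_mul, sum_jointTransition, one_mul]

theorem stepOp_pow_const (r : ℝ) (t : ℕ) :
    (stepOp α β k ^ t) (fun _ : BroadcastState n => r) = fun _ => r := by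
  induction t with
  | zero => simp
  | succ t ih => rw [stepOp_pow_succ, ih, stepOp_const]

/-- The invariant may depend on time, so that pathwise bounds such as "at most one packet per slot
so far" can be used under the expectation. -/
theorem stepOp_pow_le_of_invariant (h : IsChannelParam α β) (I : ℕ → BroadcastState n → Prop)
    (hI : ∀ t x a, I t x → I (t + 1) (a, rlncUpdate k x.2 a)) (F G : BroadcastState n → ℝ) :
    ∀ (t j : ℕ) (x : BroadcastState n), I j x → (∀ y, I (j + t) y → F y ≤ G y) →
      (stepOp α β k ^ t) F x ≤ (stepOp α β k ^ t) G x := by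
  intro t
  induction t with
  | zero => intro j x hx hFG; simpa using hFG x hx
  | succ t ih =>
    intro j x hx hFG
    rw [stepOp_pow_succ, stepOp_pow_succ]
    exact stepOp_le h fun a => ih (j + 1) _ (hI _ _ _ hx) fun y hy => hFG y (by
      rwa [add_assoc, add_comm 1 t] at hy)

theorem stepOp_pow_mono (h : IsChannelParam α β) {F G : BroadcastState n → ℝ}
    (hFG : ∀ x, F x ≤ G x) (t : ℕ) (x : BroadcastState n) :
    (stepOp α β k ^ t) F x ≤ (stepOp α β k ^ t) G x :=
  stepOp_pow_le_of_invariant h (fun _ _ => True) (fun _ _ _ _ => trivial) F G t 0 x trivial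
    fun y _ => hFG y

theorem stepOp_pow_le_of_drift (h : IsChannelParam α β) (I : BroadcastState n → Prop)
    (hI : ∀ x a, I x → I (a, rlncUpdate k x.2 a)) (G : BroadcastState n → ℝ) (d : ℝ)
    (hG : ∀ x, I x → stepOp α β k G x ≤ G x + d) (t : ℕ) :
    ∀ x, I x → (stepOp α β k ^ t) G x ≤ G x + d * t := by
  induction t with
  | zero => intro x _; simp
  | succ t ih =>
    intro x hx
    rw [stepOp_pow_succ]
    calc stepOp α β k ((stepOp α β k ^ t) G) x
        ≤ stepOp α β k (G + fun _ => d * t) x := stepOp_le h fun a => ih _ (hI _ _ hx)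
      _ = stepOp α β k G x + d * t := by rw [map_add, stepOp_const]; rfl
      _ ≤ G x + d * (t + 1 : ℕ) := by have := hG x hx; push_cast; linarith

/-! ### Monotonicity and near-additivity of the expected number of blocks -/

/-- The number of completed blocks. -/
def blockCount (x : BroadcastState n) : ℝ := x.2.1

/-- Expected number of blocks completed in `t` slots, starting a new block with channel
states `c`. -/
noncomputable def expectedBlocks (α β : ℝ) (k t : ℕ) (c : Fin n → Bool) : ℝ :=
  (stepOp α β k ^ t) blockCount (c, (0, fun _ => 0))

theorem stepOp_pow_blockCount_shift (t : ℕ) : ∀ (c : Fin n → Bool) (m j : ℕ) (r : Fin n → ℕ),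
    (stepOp α β k ^ t) blockCount (c, (m + j, r)) =
      (stepOp α β k ^ t) blockCount (c, (m, r)) + j := by
  induction t with
  | zero => intro c m j r; simp [blockCount]
  | succ t ih =>
    intro c m j r
    rw [stepOp_pow_succ, stepOp_apply, stepOp_apply]
    have : ∀ a, (stepOp α β k ^ t) blockCount (a, rlncUpdate k (m + j, r) a) =
        (stepOp α β k ^ t) blockCount (a, rlncUpdate k (m, r) a) + j := by
      intro a
      unfold rlncUpdate
      split_ifs
      · simp only
        rw [← ih, add_right_comm]
      · simp only
        rw [← ih]
    simp only [this, mul_add, Finset.sum_add_distrib]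
    rw [← Finset.sum_mul, sum_jointTransition, one_mul]

/-- Order of the progress of block transmissions. -/
def ProgressLE (s s' : ℕ × (Fin n → ℕ)) : Prop :=
  s.1 < s'.1 ∨ (s.1 = s'.1 ∧ ∀ i, s.2 i ≤ s'.2 i)

/-- The delicate case is a lead of one block that the trailing process closes in this slot: it then
restarts from zero counts, so it is still not ahead. -/
theorem ProgressLE.update {s s' : ℕ × (Fin n → ℕ)} (hs : ProgressLE s s') (k : ℕ)
    (a : Fin n → Bool) : ProgressLE (rlncUpdate k s a) (rlncUpdate k s' a) := by
  rcases hs with hs | ⟨hs, hr⟩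
  · have h1 := rlncUpdate_fst_le k s a
    have h2 := le_rlncUpdate_fst k s' a
    by_cases hlt : (rlncUpdate k s a).1 < (rlncUpdate k s' a).1
    · exact Or.inl hlt
    · refine Or.inr ⟨by omega, fun i => ?_⟩
      have h3 : (rlncUpdate k s a).1 = s.1 + 1 := by omega
      by_cases hc : ∀ i, k ≤ receivedCount s.2 a i
      · simp [rlncUpdate_of_complete hc]
      · simp [rlncUpdate_of_not_complete hc] at h3
  · have hle : ∀ i, receivedCount s.2 a i ≤ receivedCount s'.2 a i := fun i =>
      Nat.add_le_add_right (hr i) _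
    by_cases hc : ∀ i, k ≤ receivedCount s.2 a i
    · have hc' : ∀ i, k ≤ receivedCount s'.2 a i := fun i => (hc i).trans (hle i)
      rw [rlncUpdate_of_complete hc, rlncUpdate_of_complete hc']
      exact Or.inr ⟨by simp [hs], fun i => le_rfl⟩
    · rw [rlncUpdate_of_not_complete hc]
      by_cases hc' : ∀ i, k ≤ receivedCount s'.2 a i
      · rw [rlncUpdate_of_complete hc']
        exact Or.inl (by simp [hs])
      · rw [rlncUpdate_of_not_complete hc']
        exact Or.inr ⟨hs, hle⟩

theorem stepOp_pow_blockCount_mono (h : IsChannelParam α β) (t : ℕ) :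
    ∀ (c : Fin n → Bool) {s s' : ℕ × (Fin n → ℕ)}, ProgressLE s s' →
      (stepOp α β k ^ t) blockCount (c, s) ≤ (stepOp α β k ^ t) blockCount (c, s') := by
  induction t with
  | zero =>
    intro c s s' hs
    have : s.1 ≤ s'.1 := hs.elim le_of_lt fun h => h.1.le
    simpa [blockCount] using this
  | succ t ih =>
    intro c s s' hs
    rw [stepOp_pow_succ, stepOp_apply, stepOp_apply]
    exact Finset.sum_le_sum fun a _ =>
      mul_le_mul_of_nonneg_left (ih a (hs.update k a)) (jointTransition_nonneg h _ _)

/-- Partial counts only help, so discarding them gives a lower bound; granting a whole extra block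
gives the matching upper bound `stepOp_pow_blockCount_le`. -/
theorem le_stepOp_pow_blockCount (h : IsChannelParam α β) (t : ℕ) (x : BroadcastState n) :
    blockCount x + expectedBlocks α β k t x.1 ≤ (stepOp α β k ^ t) blockCount x := by
  obtain ⟨c, m, r⟩ := x
  have h1 := stepOp_pow_blockCount_shift (α := α) (β := β) (k := k) t c 0 m (fun _ => 0)
  have h2 := stepOp_pow_blockCount_mono (k := k) h t c
    (s := (0 + m, fun _ => 0)) (s' := (m, r)) (Or.inr ⟨by simp, by simp⟩)
  simp only [expectedBlocks, blockCount] at *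
  linarith

theorem stepOp_pow_blockCount_le (h : IsChannelParam α β) (t : ℕ) (x : BroadcastState n) :
    (stepOp α β k ^ t) blockCount x ≤ blockCount x + expectedBlocks α β k t x.1 + 1 := by
  obtain ⟨c, m, r⟩ := x
  have h1 := stepOp_pow_blockCount_shift (α := α) (β := β) (k := k) t c 0 (m + 1) (fun _ => 0)
  have h2 := stepOp_pow_blockCount_mono (k := k) h t c
    (s' := (0 + (m + 1), fun _ => 0)) (s := (m, r)) (Or.inl (by simp))
  simp only [expectedBlocks, blockCount] at *
  push_cast at h1
  linarith

theorem expectedBlocks_nonneg (h : IsChannelParam α β) (t : ℕ) (c : Fin n → Bool) :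
    0 ≤ expectedBlocks α β k t c := by
  have := stepOp_pow_mono (k := k) h (F := fun _ => 0) (G := blockCount)
    (fun x : BroadcastState n => Nat.cast_nonneg _) t (c, (0, fun _ => 0))
  rwa [stepOp_pow_const] at this

theorem expectedBlocks_add_le (h : IsChannelParam α β) (s t : ℕ) (c : Fin n → Bool) :
    expectedBlocks α β k (s + t) c ≤ expectedBlocks α β k s c +
      (stepOp α β k ^ s) (fun x => expectedBlocks α β k t x.1) (c, (0, fun _ => 0)) + 1 := by
  unfold expectedBlocks
  rw [stepOp_pow_add]
  refine (stepOp_pow_mono h (stepOp_pow_blockCount_le h t) s _).trans_eq ?_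
  have : (fun x : BroadcastState n => blockCount x + expectedBlocks α β k t x.1 + 1) =
    blockCount + (fun x => expectedBlocks α β k t x.1) + (fun _ => 1) := rfl
  rw [this, map_add, map_add, stepOp_pow_const]
  rfl

theorem le_expectedBlocks_add (h : IsChannelParam α β) (s t : ℕ) (c : Fin n → Bool) :
    expectedBlocks α β k s c +
      (stepOp α β k ^ s) (fun x => expectedBlocks α β k t x.1) (c, (0, fun _ => 0)) ≤
      expectedBlocks α β k (s + t) c := by
  unfold expectedBlocks
  rw [stepOp_pow_add]
  refine le_trans (le_of_eq ?_) (stepOp_pow_mono h (le_stepOp_pow_blockCount h t) s _)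
  have : (fun x : BroadcastState n => blockCount x + expectedBlocks α β k t x.1) =
    blockCount + (fun x => expectedBlocks α β k t x.1) := rfl
  rw [this, map_add]
  rfl

theorem expectedBlocks_add_le_of_le (h : IsChannelParam α β) (s t : ℕ) (c : Fin n → Bool) {u : ℝ}
    (hu : ∀ a : Fin n → Bool, expectedBlocks α β k t a ≤ u) :
    expectedBlocks α β k (s + t) c ≤ expectedBlocks α β k s c + u + 1 := by
  have h1 := expectedBlocks_add_le (k := k) h s t c
  have h2 := stepOp_pow_mono (k := k) h (F := fun x => expectedBlocks α β k t x.1)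
    (G := fun _ => u) (fun x => hu x.1) s (c, (0, fun _ => 0))
  rw [stepOp_pow_const] at h2
  linarith

end stepOp

/-! ### Doeblin minorization, variance and convergence of the mean rate -/

/-- The common target is ON if `α < 1`. If `α = 1`, then `α + β ≠ 2` gives `β < 1` and OFF works;
this excludes the periodic chain. -/
theorem exists_pos_le_channelTransition {α β : ℝ} (h : IsChannelParam α β) :
    ∃ (b₀ : Bool) (δ : ℝ), 0 < δ ∧ ∀ b, δ ≤ channelTransition α β b b₀ := by
  obtain ⟨h1, h2, h3, h4, h5⟩ := h
  rcases h2.lt_or_eq with h2 | rfl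
  · refine ⟨true, min (1 - α) β, lt_min (by linarith) h3, fun b => ?_⟩
    cases b <;> simp [channelTransition]
  · have : β < 1 := lt_of_le_of_ne h4 fun h => h5 (by rw [h]; norm_num)
    refine ⟨false, 1 - β, by linarith, fun b => ?_⟩
    cases b <;> simp [channelTransition, h3.le]

theorem exists_pos_le_jointTransition {α β : ℝ} (h : IsChannelParam α β) (n : ℕ) :
    ∃ (a₀ : Fin n → Bool) (ε : ℝ), 0 < ε ∧ ∀ c, ε ≤ jointTransition α β c a₀ := by
  obtain ⟨b₀, δ, hδ, hle⟩ := exists_pos_le_channelTransition h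
  refine ⟨fun _ => b₀, δ ^ n, by positivity, fun c => ?_⟩
  calc δ ^ n = ∏ _i : Fin n, δ := by simp
    _ ≤ _ := Finset.prod_le_prod (fun _ _ => hδ.le) fun i _ => hle _

/-- Both laws put mass at least `ε` on `a₀`, and this common mass cancels in the difference; only
the fraction `1 - ε` feels the oscillation of `f`. -/
theorem sum_jointTransition_mul_sub_le {α β : ℝ} (h : IsChannelParam α β) {n : ℕ}
    {a₀ : Fin n → Bool} {ε : ℝ} (hε : ∀ c, ε ≤ jointTransition α β c a₀)
    (f : (Fin n → Bool) → ℝ) {d : ℝ} (hf : ∀ c c', f c - f c' ≤ d) (hε1 : ε ≤ 1)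
    (c c' : Fin n → Bool) :
    ∑ a, jointTransition α β c a * f a - ∑ a, jointTransition α β c' a * f a ≤ (1 - ε) * d := by
  obtain ⟨u, -, hu⟩ := Finset.exists_max_image Finset.univ f Finset.univ_nonempty
  obtain ⟨v, -, hv⟩ := Finset.exists_min_image Finset.univ f Finset.univ_nonempty
  have h1 : ε * (f u - f a₀) ≤ ∑ a, jointTransition α β c a * (f u - f a) :=
    (mul_le_mul_of_nonneg_right (hε c) (by linarith [hu a₀ (Finset.mem_univ _)])).trans
      (Finset.single_le_sum (f := fun a => jointTransition α β c a * (f u - f a))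
        (fun a _ => mul_nonneg (jointTransition_nonneg h _ _)
          (by linarith [hu a (Finset.mem_univ _)])) (Finset.mem_univ a₀))
  have h2 : ε * (f a₀ - f v) ≤ ∑ a, jointTransition α β c' a * (f a - f v) :=
    (mul_le_mul_of_nonneg_right (hε c') (by linarith [hv a₀ (Finset.mem_univ _)])).trans
      (Finset.single_le_sum (f := fun a => jointTransition α β c' a * (f a - f v))
        (fun a _ => mul_nonneg (jointTransition_nonneg h _ _)
          (by linarith [hv a (Finset.mem_univ _)])) (Finset.mem_univ a₀))
  simp only [mul_sub, Finset.sum_sub_distrib, ← Finset.sum_mul, sum_jointTransition,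
    one_mul] at h1 h2
  have h3 := mul_le_mul_of_nonneg_left (hf u v) (by linarith : 0 ≤ 1 - ε)
  linarith

section

variable {α β : ℝ} {n k : ℕ}

theorem expectedBlocks_le (h : IsChannelParam α β) (t : ℕ) (c : Fin n → Bool) :
    expectedBlocks α β k t c ≤ t := by
  have := stepOp_pow_le_of_drift (k := k) h (fun _ => True) (fun _ _ _ => trivial)
    (blockCount (n := n)) 1 (fun x _ => by
      have h1 := stepOp_le (k := k) h (F := blockCount) (x := x)
        (G := fun _ => blockCount x + 1) (fun a => by
          have := rlncUpdate_fst_le k x.2 a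
          simp only [blockCount]
          exact_mod_cast this)
      rwa [stepOp_const] at h1) t (c, (0, fun _ => 0)) trivial
  simpa [blockCount, expectedBlocks] using this

theorem exists_expectedBlocks_sub_le (h : IsChannelParam α β) (n k : ℕ) :
    ∃ K : ℝ, 0 ≤ K ∧ ∀ (t : ℕ) (c c' : Fin n → Bool),
      expectedBlocks α β k t c - expectedBlocks α β k t c' ≤ K := by
  obtain ⟨a₀, ε, hε, hle⟩ := exists_pos_le_jointTransition h n
  have hε1 : ε ≤ 1 := by
    rw [← sum_jointTransition α β a₀]
    exact (hle a₀).trans (Finset.single_le_sum (f := fun a => jointTransition α β a₀ a)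
      (fun a _ => jointTransition_nonneg h _ _) (Finset.mem_univ a₀))
  -- Fixed point of `d ↦ (1 - ε) * d + 2`; the 2 is one block from the first slot plus one from the
  -- defect of additivity.
  refine ⟨2 / ε, by positivity, fun t => ?_⟩
  induction t with
  | zero =>
    intro c c'
    have : (0 : ℝ) ≤ 2 / ε := by positivity
    simpa [expectedBlocks, blockCount] using this
  | succ t ih =>
    intro c c'
    have h1 := expectedBlocks_add_le (k := k) h 1 t c
    have h2 := le_expectedBlocks_add (k := k) h 1 t c'
    have h3 := expectedBlocks_le (k := k) h 1 c
    have h4 := expectedBlocks_nonneg (k := k) h 1 c'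
    have h5 := sum_jointTransition_mul_sub_le h hle _ ih hε1 c c'
    have h6 : (1 - ε) * (2 / ε) = 2 / ε - 2 := by field_simp
    rw [pow_one, stepOp_apply] at h1 h2
    rw [add_comm t 1]
    push_cast at h3
    simp only at h1 h2 h5
    linarith

theorem stepOp_sq_sub_sq_le (F : BroadcastState n → ℝ) (κ : ℝ) (x : BroadcastState n) :
    stepOp α β k (fun y => F y ^ 2) x - stepOp α β k F x ^ 2 ≤
      stepOp α β k (fun y => (F y - κ) ^ 2) x := by
  have h1 : (fun y => (F y - κ) ^ 2) =
      (fun y => F y ^ 2) - (2 * κ) • F + fun _ => κ ^ 2 := by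
    funext y
    simp only [Pi.add_apply, Pi.sub_apply, Pi.smul_apply, smul_eq_mul]
    ring
  rw [h1, map_add, map_sub, map_smul, stepOp_const]
  simp only [Pi.add_apply, Pi.sub_apply, Pi.smul_apply, smul_eq_mul]
  nlinarith [sq_nonneg (stepOp α β k F x - κ)]

/-- Total variance, conditioning on the first slot. The conditional variance is bounded by
induction. The conditional mean varies by at most `K + 2`: `K` from the channel states, one from a
completed block, one from the partial counts. -/
theorem stepOp_pow_blockCount_variance_le (h : IsChannelParam α β) {K : ℝ}
    (hK : ∀ (t : ℕ) (c c' : Fin n → Bool),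
      expectedBlocks α β k t c - expectedBlocks α β k t c' ≤ K) (t : ℕ) :
    ∀ x : BroadcastState n,
      (stepOp α β k ^ t) (fun y => blockCount y ^ 2) x - (stepOp α β k ^ t) blockCount x ^ 2 ≤
        (K + 2) ^ 2 * t := by
  induction t with
  | zero => intro x; simp
  | succ t ih =>
    intro x
    rw [stepOp_pow_succ, stepOp_pow_succ]
    set f := (stepOp α β k ^ t) (blockCount (n := n)) with hf
    have h1 : stepOp α β k ((stepOp α β k ^ t) fun y => blockCount y ^ 2) x ≤
        stepOp α β k ((fun y => f y ^ 2) + fun _ => (K + 2) ^ 2 * t) x :=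
      stepOp_le h fun a => by
        have := ih (a, rlncUpdate k x.2 a)
        simp only [Pi.add_apply]
        linarith
    rw [map_add, stepOp_const] at h1
    have h2 := stepOp_sq_sub_sq_le (α := α) (β := β) (k := k) f
      (blockCount x + expectedBlocks α β k t x.1) x
    have h3 := stepOp_le (k := k) h (x := x)
      (F := fun y => (f y - (blockCount x + expectedBlocks α β k t x.1)) ^ 2)
      (G := fun _ => (K + 2) ^ 2) (fun a => by
        have e1 := le_stepOp_pow_blockCount (k := k) h t (a, rlncUpdate k x.2 a)
        have e2 := stepOp_pow_blockCount_le (k := k) h t (a, rlncUpdate k x.2 a)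
        have e3 := hK t a x.1
        have e4 := hK t x.1 a
        have e5 : blockCount x ≤ blockCount (a, rlncUpdate k x.2 a) :=
          Nat.cast_le.2 (le_rlncUpdate_fst k x.2 a)
        have e6 : blockCount (a, rlncUpdate k x.2 a) ≤ blockCount x + 1 := by
          have := rlncUpdate_fst_le k x.2 a
          simp only [blockCount]
          exact_mod_cast this
        rw [← hf] at e1 e2
        simp only at e1 e2 ⊢
        exact sq_le_sq' (by linarith) (by linarith))
    rw [stepOp_const] at h3
    simp only [Pi.add_apply] at h1
    push_cast
    linarith

theorem exists_tendsto_expectedBlocks_div (h : IsChannelParam α β) (n k : ℕ) :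
    ∃ g : ℝ, Tendsto (fun t : ℕ => expectedBlocks α β k t (fun _ : Fin n => true) / t)
      atTop (𝓝 g) := by
  obtain ⟨K, hK0, hK⟩ := exists_expectedBlocks_sub_le h n k
  have hsub : Subadditive
      (fun t => expectedBlocks α β k t (fun _ : Fin n => true) + (K + 1)) := by
    intro s t
    have := expectedBlocks_add_le_of_le (k := k) h s t (fun _ : Fin n => true)
      (u := expectedBlocks α β k t (fun _ : Fin n => true) + K)
      (fun a => by linarith [hK t a fun _ => true])
    linarith
  have hlim := hsub.tendsto_lim ⟨0, by
    rintro _ ⟨t, rfl⟩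
    have := expectedBlocks_nonneg (k := k) h t (fun _ : Fin n => true)
    positivity⟩
  refine ⟨hsub.lim, ?_⟩
  have h0 := hlim.sub (tendsto_const_div_atTop_nhds_zero_nat (K + 1))
  rw [sub_zero] at h0
  exact h0.congr fun t => by ring

end

/-! ### From the operator to almost sure convergence -/

section

variable {n : ℕ} {Ω : Type*} {C : Fin n → ℕ → Ω → Bool}

theorem rlncState_congr {c c' : Fin n → ℕ → Bool} {k t : ℕ}
    (hc : ∀ s ≤ t, ∀ i, c i s = c' i s) : rlncState c k t = rlncState c' k t := by
  induction t with
  | zero => rfl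
  | succ t ih =>
    rw [rlncState_succ, rlncState_succ, ih fun s hs => hc s (by omega)]
    simp only [hc (t + 1) le_rfl]

/-- The channel states of all users in the slots `0, …, t`. -/
def channelHistory (C : Fin n → ℕ → Ω → Bool) (t : ℕ) (ω : Ω) : Fin (t + 1) → Fin n → Bool :=
  fun s i => C i s ω

/-- Extension of finitely many channel states to an infinite sequence. -/
def extendHistory {t : ℕ} (d : Fin (t + 1) → Fin n → Bool) (i : Fin n) (s : ℕ) : Bool :=
  d (Fin.ofNat (t + 1) s) i

/-- The broadcast state after the slot `t`. -/
def broadcastState (C : Fin n → ℕ → Ω → Bool) (k t : ℕ) (ω : Ω) : BroadcastState n :=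
  (fun i => C i t ω, rlncState (fun i s => C i s ω) k t)

theorem extendHistory_of_le {t s : ℕ} (d : Fin (t + 1) → Fin n → Bool) (i : Fin n) (hs : s ≤ t) :
    extendHistory d i s = d ⟨s, by omega⟩ i := by
  unfold extendHistory
  congr 1
  ext
  simp [Fin.ofNat, Nat.mod_eq_of_lt (show s < t + 1 by omega)]

theorem channelHistory_preimage_singleton (t : ℕ) (d : Fin (t + 1) → Fin n → Bool) :
    channelHistory C t ⁻¹' {d} = {ω | ∀ s ≤ t, ∀ i, C i s ω = extendHistory d i s} := by
  ext ω
  simp only [Set.mem_preimage, Set.mem_singleton_iff, Set.mem_ofPred_eq]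
  constructor
  · rintro rfl s hs i
    rw [extendHistory_of_le _ _ hs]
    rfl
  · intro h
    funext s i
    have := h s (by omega) i
    rwa [extendHistory_of_le _ _ (by omega)] at this

theorem extendHistory_snoc_of_le {t s : ℕ} (d : Fin (t + 1) → Fin n → Bool) (a : Fin n → Bool)
    (i : Fin n) (hs : s ≤ t) :
    extendHistory (Fin.snoc d a : Fin (t + 2) → Fin n → Bool) i s = extendHistory d i s := by
  rw [extendHistory_of_le _ _ (by omega), extendHistory_of_le _ _ hs]
  have : (⟨s, by omega⟩ : Fin (t + 2)) = Fin.castSucc ⟨s, by omega⟩ := rfl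
  rw [this, Fin.snoc_castSucc (α := fun _ => Fin n → Bool)]

theorem extendHistory_snoc_last {t : ℕ} (d : Fin (t + 1) → Fin n → Bool) (a : Fin n → Bool)
    (i : Fin n) :
    extendHistory (Fin.snoc d a : Fin (t + 2) → Fin n → Bool) i (t + 1) = a i := by
  rw [extendHistory_of_le _ _ le_rfl]
  have : (⟨t + 1, by omega⟩ : Fin (t + 2)) = Fin.last (t + 1) := rfl
  rw [this, Fin.snoc_last (α := fun _ => Fin n → Bool)]

/-- The broadcast state after the slot `t`, in terms of the channel states up to this slot. -/
def historyState (k : ℕ) {t : ℕ} (d : Fin (t + 1) → Fin n → Bool) : BroadcastState n :=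
  (fun i => extendHistory d i t, rlncState (extendHistory d) k t)

theorem broadcastState_eq (k t : ℕ) (ω : Ω) :
    broadcastState C k t ω = historyState k (channelHistory C t ω) := by
  have h : ∀ s ≤ t, ∀ i, C i s ω = extendHistory (channelHistory C t ω) i s := fun s hs i => by
    rw [extendHistory_of_le _ _ hs]; rfl
  unfold broadcastState historyState
  rw [rlncState_congr h]
  simp only [h t le_rfl]

theorem historyState_snoc (k : ℕ) {t : ℕ} (d : Fin (t + 1) → Fin n → Bool) (a : Fin n → Bool) :
    historyState k (Fin.snoc d a : Fin (t + 2) → Fin n → Bool) =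
      (a, rlncUpdate k (historyState k d).2 a) := by
  unfold historyState
  rw [rlncState_succ, rlncState_congr fun s hs i => extendHistory_snoc_of_le d a i hs]
  simp only [extendHistory_snoc_last]

theorem rlncState_fst_mono (c : Fin n → ℕ → Bool) (k : ℕ) :
    Monotone fun t => (rlncState c k t).1 :=
  monotone_nat_of_le_succ fun t => by
    rw [rlncState_succ]
    exact le_rlncUpdate_fst _ _ _

variable {α β : ℝ} [MeasurableSpace Ω] {P : Measure Ω}

theorem IsErasureChannelSystem.measurable_channelHistory
    (hC : IsErasureChannelSystem α β P C) (t : ℕ) : Measurable (channelHistory C t) :=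
  measurable_pi_lambda _ fun _ => measurable_pi_lambda _ fun _ => hC.measurable _ _

theorem IsErasureChannelSystem.real_forall_eq_prod [IsProbabilityMeasure P]
    (hC : IsErasureChannelSystem α β P C) (t : ℕ) (c : ℕ → Fin n → Bool) :
    P.real {ω | ∀ s ≤ t, ∀ i, C i s ω = c s i} =
      ∏ i, P.real {ω | ∀ s ≤ t, C i s ω = c s i} := by
  have hm : ∀ i ∈ (Finset.univ : Finset (Fin n)),
      MeasurableSet {x : ℕ → Bool | ∀ s ≤ t, x s = c s i} := by
    intro i _
    have : {x : ℕ → Bool | ∀ s ≤ t, x s = c s i} =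
        ⋂ s, ⋂ (_ : s ≤ t), (fun x : ℕ → Bool => x s) ⁻¹' {c s i} := by
      ext x; simp
    rw [this]
    exact MeasurableSet.iInter fun s => MeasurableSet.iInter fun _ =>
      measurable_pi_apply s (measurableSet_singleton _)
  have := hC.indep.measure_inter_preimage_eq_mul Finset.univ hm
  simp only [Measure.real, ← ENNReal.toReal_prod]
  congr 1
  refine Eq.trans (congrArg P ?_) this
  ext ω
  simp only [Set.mem_ofPred_eq, Finset.mem_univ, Set.iInter_true, Set.mem_iInter, Set.mem_preimage]
  exact ⟨fun h i s hs => h s hs i, fun h s hs i => h i s hs⟩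

theorem IsErasureChannelSystem.real_forall_succ [IsProbabilityMeasure P]
    (hC : IsErasureChannelSystem α β P C) (t : ℕ) (c : ℕ → Fin n → Bool) :
    P.real {ω | ∀ s ≤ t + 1, ∀ i, C i s ω = c s i} =
      P.real {ω | ∀ s ≤ t, ∀ i, C i s ω = c s i} * jointTransition α β (c t) (c (t + 1)) := by
  rw [hC.real_forall_eq_prod, hC.real_forall_eq_prod, jointTransition, ← Finset.prod_mul_distrib]
  exact Finset.prod_congr rfl fun i _ => hC.markov i t fun s => c s i

theorem IsErasureChannelSystem.real_channelHistory_snoc [IsProbabilityMeasure P]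
    (hC : IsErasureChannelSystem α β P C) (t : ℕ) (d : Fin (t + 1) → Fin n → Bool)
    (a : Fin n → Bool) :
    P.real (channelHistory C (t + 1) ⁻¹' {Fin.snoc d a}) =
      P.real (channelHistory C t ⁻¹' {d}) *
        jointTransition α β (fun i => extendHistory d i t) a := by
  rw [channelHistory_preimage_singleton, channelHistory_preimage_singleton]
  have := hC.real_forall_succ t fun s i =>
    extendHistory (Fin.snoc d a : Fin (t + 2) → Fin n → Bool) i s
  rw [this]
  congr 1
  · congr 1
    ext ω
    exact forall₂_congr fun s hs => forall_congr' fun i => by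
      rw [extendHistory_snoc_of_le _ _ _ hs]
  · simp only [extendHistory_snoc_of_le _ _ _ le_rfl, extendHistory_snoc_last]

theorem IsErasureChannelSystem.integral_channelHistory [IsProbabilityMeasure P]
    (hC : IsErasureChannelSystem α β P C) (t : ℕ) (Φ : (Fin (t + 1) → Fin n → Bool) → ℝ) :
    ∫ ω, Φ (channelHistory C t ω) ∂P = ∑ d, P.real (channelHistory C t ⁻¹' {d}) * Φ d := by
  have hm := hC.measurable_channelHistory t
  have : IsProbabilityMeasure (P.map (channelHistory C t)) :=
    Measure.isProbabilityMeasure_map hm.aemeasurable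
  rw [← integral_map hm.aemeasurable (Measurable.of_discrete.aestronglyMeasurable),
    integral_fintype Integrable.of_finite]
  refine Finset.sum_congr rfl fun d _ => ?_
  rw [map_measureReal_apply hm (measurableSet_singleton d), smul_eq_mul]

theorem IsErasureChannelSystem.integrable_channelHistory [IsProbabilityMeasure P]
    (hC : IsErasureChannelSystem α β P C) (t : ℕ) (Φ : (Fin (t + 1) → Fin n → Bool) → ℝ) :
    Integrable (fun ω => Φ (channelHistory C t ω)) P := by
  have hm := hC.measurable_channelHistory t
  have : IsProbabilityMeasure (P.map (channelHistory C t)) :=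
    Measure.isProbabilityMeasure_map hm.aemeasurable
  exact (Integrable.of_finite (μ := P.map (channelHistory C t)) (f := Φ)).comp_measurable hm

theorem IsErasureChannelSystem.integrable_broadcastState [IsProbabilityMeasure P]
    (hC : IsErasureChannelSystem α β P C) (k t : ℕ) (F : BroadcastState n → ℝ) :
    Integrable (fun ω => F (broadcastState C k t ω)) P := by
  simp only [broadcastState_eq]
  exact hC.integrable_channelHistory t fun d => F (historyState k d)

/-- The state is a function of a finite-valued history whose law factorises, so the Markov property
is a finite sum split at the last slot. -/
theorem IsErasureChannelSystem.integral_broadcastState_succ [IsProbabilityMeasure P]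
    (hC : IsErasureChannelSystem α β P C) (k t : ℕ) (F : BroadcastState n → ℝ) :
    ∫ ω, F (broadcastState C k (t + 1) ω) ∂P =
      ∫ ω, stepOp α β k F (broadcastState C k t ω) ∂P := by
  simp only [broadcastState_eq]
  rw [hC.integral_channelHistory (t + 1) fun d => F (historyState k d),
    hC.integral_channelHistory t fun d => stepOp α β k F (historyState k d),
    ← (Fin.snocEquiv fun _ : Fin (t + 2) => Fin n → Bool).sum_comp, Fintype.sum_prod_type_right]
  refine Finset.sum_congr rfl fun d _ => ?_
  rw [stepOp_apply, Finset.mul_sum]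
  refine Finset.sum_congr rfl fun a _ => ?_
  have : (Fin.snocEquiv fun _ : Fin (t + 2) => Fin n → Bool) (a, d) = Fin.snoc d a := rfl
  rw [this, hC.real_channelHistory_snoc, historyState_snoc, mul_assoc]
  rfl

theorem IsErasureChannelSystem.integral_broadcastState [IsProbabilityMeasure P]
    (hC : IsErasureChannelSystem α β P C) (k t : ℕ) :
    ∀ F : BroadcastState n → ℝ, ∫ ω, F (broadcastState C k t ω) ∂P =
      (stepOp α β k ^ t) F (fun _ => true, (0, fun _ => 0)) := by
  induction t with
  | zero =>
    intro F
    have : ∀ᵐ ω ∂P, F (broadcastState C k 0 ω) = F (fun _ => true, (0, fun _ => 0)) := by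
      filter_upwards [ae_all_iff.2 hC.start_on] with ω hω
      simp only [broadcastState, hω]
      rfl
    rw [integral_congr_ae this]
    simp
  | succ t ih =>
    intro F
    rw [hC.integral_broadcastState_succ, ih, pow_succ]
    rfl

/-- A sequence whose second moments are summable tends to zero almost surely. -/
theorem ae_tendsto_zero_of_summable_integral_sq {Y : ℕ → Ω → ℝ} {b : ℕ → ℝ} (hb : Summable b)
    (hY : ∀ j, Integrable (fun ω => Y j ω ^ 2) P) (hYb : ∀ j, ∫ ω, Y j ω ^ 2 ∂P ≤ b j) :
    ∀ᵐ ω ∂P, Tendsto (fun j => Y j ω) atTop (𝓝 0) := by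
  have hm : ∀ j, AEMeasurable (fun ω => ENNReal.ofReal (Y j ω ^ 2)) P := fun j =>
    (hY j).aestronglyMeasurable.aemeasurable.ennreal_ofReal
  have h0 : ∀ j, 0 ≤ b j := fun j => (integral_nonneg fun _ => sq_nonneg _).trans (hYb j)
  have hfin : ∫⁻ ω, ∑' j, ENNReal.ofReal (Y j ω ^ 2) ∂P ≠ ⊤ := by
    rw [lintegral_tsum hm]
    refine ne_top_of_le_ne_top ?_ (ENNReal.tsum_le_tsum (g := fun j => ENNReal.ofReal (b j)) ?_)
    · rw [← ENNReal.ofReal_tsum_of_nonneg h0 hb]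
      exact ENNReal.ofReal_ne_top
    · intro j
      rw [← ofReal_integral_eq_lintegral_ofReal (hY j) (ae_of_all _ fun _ => sq_nonneg _)]
      exact ENNReal.ofReal_le_ofReal (hYb j)
  filter_upwards [ae_lt_top' (AEMeasurable.tsum hm) hfin] with ω hω
  have h1 := (ENNReal.tendsto_toReal ENNReal.zero_ne_top).comp
    (ENNReal.tendsto_atTop_zero_of_tsum_ne_top hω.ne)
  have h2 : Tendsto (fun j => Y j ω ^ 2) atTop (𝓝 0) := by
    simpa [Function.comp_def, ENNReal.toReal_ofReal (sq_nonneg _)] using h1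
  have h3 := h2.sqrt
  simp only [Real.sqrt_sq_eq_abs, Real.sqrt_zero] at h3
  exact (tendsto_zero_iff_abs_tendsto_zero _).2 h3

theorem IsErasureChannelSystem.isThroughput [IsProbabilityMeasure P]
    (hC : IsErasureChannelSystem α β P C) (h : IsChannelParam α β) (k : ℕ) {g : ℝ}
    (hg : Tendsto (fun t : ℕ => expectedBlocks α β k t (fun _ : Fin n => true) / t)
      atTop (𝓝 g)) : IsThroughput P C k (k * g) := by
  obtain ⟨K, -, hK⟩ := exists_expectedBlocks_sub_le h n k
  set A : ℕ → ℝ := fun t => expectedBlocks α β k t (fun _ : Fin n => true)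
  let N : ℕ → Ω → ℝ := fun t ω => blockCount (broadcastState C k t ω)
  have hvar : ∀ t, ∫ ω, (N t ω - A t) ^ 2 ∂P ≤ (K + 2) ^ 2 * t := by
    intro t
    have h1 : ∫ ω, (N t ω - A t) ^ 2 ∂P = (stepOp α β k ^ t)
        (fun y => (blockCount y - A t) ^ 2) (fun _ : Fin n => true, (0, fun _ => 0)) :=
      hC.integral_broadcastState k t fun y => (blockCount y - A t) ^ 2
    have h2 : (fun y : BroadcastState n => (blockCount y - A t) ^ 2) =
        (fun y => blockCount y ^ 2) - (2 * A t) • blockCount + fun _ => A t ^ 2 := by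
      funext y
      simp only [Pi.add_apply, Pi.sub_apply, Pi.smul_apply, smul_eq_mul]
      ring
    have h3 := stepOp_pow_blockCount_variance_le (k := k) h hK t
      (fun _ : Fin n => true, (0, fun _ => 0))
    have h4 : (stepOp α β k ^ t) blockCount (fun _ : Fin n => true, (0, fun _ => 0)) = A t := rfl
    rw [h1, h2, map_add, map_sub, map_smul, stepOp_pow_const]
    simp only [Pi.add_apply, Pi.sub_apply, Pi.smul_apply, smul_eq_mul]
    rw [h4] at h3 ⊢
    linarith
  -- Along squares the variance of the normalised error is `O(1 / (j + 1) ^ 2)`, hence summable.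
  -- Consecutive squares have ratio tending to 1, so monotonicity fills the gaps.
  let c : ℕ → ℕ := fun j => (j + 1) ^ 2
  have hsum : Summable fun j : ℕ => (K + 2) ^ 2 * (1 / ((j + 1 : ℕ) : ℝ) ^ 2) :=
    ((summable_nat_add_iff (f := fun j : ℕ => 1 / (j : ℝ) ^ 2) 1).2
      (Real.summable_one_div_nat_pow.2 one_lt_two)).mul_left _
  have hc : Tendsto c atTop atTop :=
    (tendsto_pow_atTop two_ne_zero).comp (tendsto_add_atTop_nat 1)
  have key := ae_tendsto_zero_of_summable_integral_sq (P := P)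
    (Y := fun j ω => (N (c j) ω - A (c j)) / c j) hsum
    (fun j => hC.integrable_broadcastState k (c j) fun y => ((blockCount y - A (c j)) / c j) ^ 2)
    (fun j => by
      have hp : (0 : ℝ) < ((j + 1 : ℕ) : ℝ) := by positivity
      simp only [div_pow]
      rw [integral_div, div_le_iff₀ (by positivity)]
      refine (hvar (c j)).trans_eq ?_
      simp only [c, Nat.cast_pow]
      field_simp)
  filter_upwards [key] with ω hω
  have hsub : Tendsto (fun j => N (c j) ω / c j) atTop (𝓝 g) := by
    have := hω.add (hg.comp hc)
    rw [zero_add] at this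
    refine this.congr fun j => ?_
    simp only [Function.comp]
    ring
  have hmono : Monotone fun t => N t ω := fun s t hst =>
    Nat.cast_le.2 (rlncState_fst_mono (fun i s => C i s ω) k hst)
  have hlim := tendsto_div_of_monotone_of_exists_subseq_tendsto_div (fun t => N t ω) g hmono
    fun a ha => ⟨c, by
      have h1 : Tendsto (fun j : ℕ => (1 + 1 / ((j : ℝ) + 1)) ^ 2) atTop (𝓝 ((1 + 0) ^ 2)) :=
        (tendsto_const_nhds.add tendsto_one_div_add_atTop_nhds_zero_nat).pow 2
      filter_upwards [h1.eventually_le_const (by simpa using ha)] with j hj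
      have hp : (0 : ℝ) < (j : ℝ) + 1 := by positivity
      have : ((c (j + 1) : ℕ) : ℝ) = (1 + 1 / ((j : ℝ) + 1)) ^ 2 * (c j : ℕ) := by
        simp only [c]
        push_cast
        field_simp
      rw [this]
      exact mul_le_mul_of_nonneg_right hj (Nat.cast_nonneg _), hc, hsub⟩
  refine (hlim.const_mul (k : ℝ)).congr fun t => ?_
  simp only [packetsTransferred, Nat.cast_mul, mul_div_assoc]
  rfl

end

/-! ### Drift estimates for the expected number of blocks -/

section

variable {α β : ℝ} {n k : ℕ}

theorem mul_rlncUpdate_add_le (k : ℕ) (s : ℕ × (Fin n → ℕ)) (a : Fin n → Bool) (i : Fin n) :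
    k * (rlncUpdate k s a).1 + (rlncUpdate k s a).2 i ≤ k * s.1 + receivedCount s.2 a i := by
  by_cases hc : ∀ i, k ≤ receivedCount s.2 a i
  · rw [rlncUpdate_of_complete hc]
    have := hc i
    simp only [mul_add]
    omega
  · rw [rlncUpdate_of_not_complete hc]

theorem mul_expectedBlocks_le (h : IsChannelParam α β) (i : Fin n) (k t : ℕ)
    (c : Fin n → Bool) :
    k * expectedBlocks α β k t c ≤
      (1 - erasureProb α β) * t + 2 * |(1 - α - β) / (α + β)| := by
  have hs : 0 < α + β := add_pos h.pos_left h.pos_right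
  -- The corrector `e * u` solves the Poisson equation of one channel: the ON indicator plus the
  -- expected change of `e * u` has mean exactly `β / (α + β)` from either state.
  set e := (1 - α - β) / (α + β) with he
  let u : Bool → ℝ := fun b => if b then 1 else 0
  let Φ : BroadcastState n → ℝ := fun x => k * x.2.1 + x.2.2 i + e * u (x.1 i)
  have hu : ∀ b, |e * u b| ≤ |e| := by
    intro b; cases b <;> simp [u]
  have hdrift : ∀ x, stepOp α β k Φ x ≤ Φ x + (1 - erasureProb α β) := by
    intro x
    have h1 : ∀ a, Φ (a, rlncUpdate k x.2 a) ≤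
        k * x.2.1 + x.2.2 i + (1 + e) * u (a i) := by
      intro a
      have h2 := mul_rlncUpdate_add_le k x.2 a i
      have h3 : ((receivedCount x.2.2 a i : ℕ) : ℝ) = x.2.2 i + u (a i) := by
        simp [receivedCount, u]
      have h4 : (k : ℝ) * (rlncUpdate k x.2 a).1 + (rlncUpdate k x.2 a).2 i ≤
          k * x.2.1 + (receivedCount x.2.2 a i : ℕ) := by exact_mod_cast h2
      simp only [Φ]
      linarith
    have h5 : stepOp α β k Φ x ≤
        ∑ a, jointTransition α β x.1 a * (k * x.2.1 + x.2.2 i + (1 + e) * u (a i)) :=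
      Finset.sum_le_sum fun a _ =>
        mul_le_mul_of_nonneg_left (h1 a) (jointTransition_nonneg h _ _)
    refine h5.trans_eq ?_
    simp only [mul_add, Finset.sum_add_distrib, ← Finset.sum_mul, sum_jointTransition, one_mul]
    rw [sum_jointTransition_mul_apply α β x.1 i fun b => (1 + e) * u b]
    have h6 : ∑ b, channelTransition α β (x.1 i) b * ((1 + e) * u b) =
        e * u (x.1 i) + (1 - erasureProb α β) := by
      cases x.1 i <;> simp [u, channelTransition, erasureProb, he] <;> field_simp <;> ring
    rw [h6]
    simp only [Φ]
    ring
  have h1 := stepOp_pow_le_of_drift (k := k) h (fun _ => True) (fun _ _ _ => trivial) Φ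
    (1 - erasureProb α β) (fun x _ => hdrift x) t (c, (0, fun _ => 0)) trivial
  have h2 := stepOp_pow_mono (k := k) h (F := (k : ℝ) • blockCount - fun _ => |e|) (G := Φ)
    (fun x => by
      have h3 := neg_le_of_abs_le (hu (x.1 i))
      have h4 : (0 : ℝ) ≤ x.2.2 i := Nat.cast_nonneg _
      simp only [Φ, blockCount, Pi.sub_apply, Pi.smul_apply, smul_eq_mul]
      linarith) t (c, (0, fun _ => 0))
  rw [map_sub, map_smul, stepOp_pow_const] at h2
  have h3 := le_of_abs_le (hu (c i))
  simp only [Pi.sub_apply, Pi.smul_apply, smul_eq_mul, Φ] at h1 h2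
  unfold expectedBlocks
  norm_num at h1
  linarith

/-- Drift of the logarithm of the sum over the users of an exponential weight. -/
theorem le_expectedBlocks_of_weight (h : IsChannelParam α β) (hk : 0 < k) (i : Fin n)
    {w : Bool → ℝ} {y θ W : ℝ} (hy : 0 < y) (hy1 : y ≤ 1) (hw : ∀ b, 0 < w b)
    (hW : ∀ b, w b ≤ W)
    (heig : ∀ b, ∑ b', channelTransition α β b b' * (y ^ (if b' then 1 else 0) * w b') ≤
      Real.exp (-θ) * w b) (t : ℕ) (c : Fin n → Bool) :
    θ * t + (Real.log (y ^ k * min (w true) (w false)) - Real.log (n * W)) ≤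
      (Real.log (n * W) - Real.log (y ^ k * w true)) * expectedBlocks α β k t c := by
  -- `D` bounds the rise of `log S` at a completion: just before the reset `S` is at least `y ^ k *
  -- w true`, after it at most `n * W`.
  set D := Real.log (n * W) - Real.log (y ^ k * w true) with hD
  let S : (Fin n → Bool) → (Fin n → ℕ) → ℝ := fun c r => ∑ j, y ^ r j * w (c j)
  have hterm : ∀ (c : Fin n → Bool) (r : Fin n → ℕ) j, 0 < y ^ r j * w (c j) :=
    fun c r j => mul_pos (pow_pos hy _) (hw _)
  have hsingle : ∀ (c : Fin n → Bool) (r : Fin n → ℕ) (j : Fin n), y ^ r j * w (c j) ≤ S c r :=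
    fun c r j => Finset.single_le_sum (f := fun j => y ^ r j * w (c j))
      (fun j _ => (hterm c r j).le) (Finset.mem_univ j)
  have hS : ∀ c r, 0 < S c r := fun c r => (hterm c r i).trans_le (hsingle c r i)
  have hreset : ∀ c, Real.log (S c fun _ => 0) ≤ Real.log (n * W) := by
    intro c
    refine Real.log_le_log (hS _ _) ?_
    calc S c (fun _ => 0) ≤ ∑ _j : Fin n, W := Finset.sum_le_sum fun j _ => by
          simpa using hW (c j)
      _ = n * W := by simp
  let Ψ : BroadcastState n → ℝ := fun x => Real.log (S x.1 x.2.2)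
  let V : BroadcastState n → ℝ := Ψ - D • blockCount
  -- After every slot some user is still short of `k` packets, because a completion resets all
  -- counts and `0 < k`.
  let I : BroadcastState n → Prop := fun x => ∃ j, x.2.2 j < k
  have hI : ∀ x a, I x → I (a, rlncUpdate k x.2 a) := by
    rintro x a -
    by_cases hc : ∀ j, k ≤ receivedCount x.2.2 a j
    · rw [rlncUpdate_of_complete hc]
      exact ⟨i, hk⟩
    · rw [rlncUpdate_of_not_complete hc]
      simpa [I] using hc
  have hdrift : ∀ x, I x → stepOp α β k V x ≤
      V x + -θ := by
    rintro x ⟨j, hj⟩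
    set B := Real.exp (-θ) * S x.1 x.2.2 with hB
    have hBpos : 0 < B := mul_pos (Real.exp_pos _) (hS _ _)
    -- The tangent to `log` at `B` replaces Jensen's inequality: the bound is linear in `S`, whose
    -- mean after the slot is at most `B`.
    have h1 : ∀ a, V (a, rlncUpdate k x.2 a) ≤
        Real.log B - 1 - D * blockCount x + S a (receivedCount x.2.2 a) * B⁻¹ := by
      intro a
      have hlog : Real.log (S a (receivedCount x.2.2 a)) ≤
          Real.log B - 1 + S a (receivedCount x.2.2 a) * B⁻¹ := by
        have := Real.log_le_sub_one_of_pos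
          (div_pos (hS a (receivedCount x.2.2 a)) hBpos)
        rw [Real.log_div (hS _ _).ne' hBpos.ne', div_eq_mul_inv] at this
        linarith
      suffices V (a, rlncUpdate k x.2 a) ≤
          Real.log (S a (receivedCount x.2.2 a)) - D * blockCount x by linarith
      by_cases hc : ∀ j, k ≤ receivedCount x.2.2 a j
      · rw [rlncUpdate_of_complete hc]
        have h2 := hc j
        -- A user short of `k` before the completing slot must be ON in it and end with exactly `k`
        -- packets, so its weight is `y ^ k * w true`.
        have h3 : a j = true := by
          by_contra hne
          simp only [receivedCount, hne] at h2
          simp at h2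
          omega
        have h4 : receivedCount x.2.2 a j = k := by
          simp only [receivedCount, h3, if_true] at h2 ⊢
          omega
        have h5 : Real.log (y ^ k * w true) ≤ Real.log (S a (receivedCount x.2.2 a)) := by
          refine Real.log_le_log (mul_pos (pow_pos hy _) (hw _)) ?_
          have := hsingle a (receivedCount x.2.2 a) j
          rwa [h4, h3] at this
        have h6 := hreset a
        simp only [V, Pi.sub_apply, Pi.smul_apply, smul_eq_mul, Ψ, blockCount]
        push_cast
        linarith
      · rw [rlncUpdate_of_not_complete hc]
        exact le_rfl
    have h2 : stepOp α β k V x ≤ ∑ a, jointTransition α β x.1 a *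
        (Real.log B - 1 - D * blockCount x + S a (receivedCount x.2.2 a) * B⁻¹) :=
      Finset.sum_le_sum fun a _ =>
        mul_le_mul_of_nonneg_left (h1 a) (jointTransition_nonneg h _ _)
    have h3 : ∑ a, jointTransition α β x.1 a * S a (receivedCount x.2.2 a) ≤ B := by
      simp only [S, Finset.mul_sum, hB]
      rw [Finset.sum_comm]
      refine Finset.sum_le_sum fun j _ => ?_
      calc ∑ a, jointTransition α β x.1 a * (y ^ receivedCount x.2.2 a j * w (a j))
          = y ^ x.2.2 j * ∑ a, jointTransition α β x.1 a *
              (y ^ (if a j then 1 else 0) * w (a j)) := by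
            rw [Finset.mul_sum]
            refine Finset.sum_congr rfl fun a _ => ?_
            rw [receivedCount, pow_add]
            ring
        _ = y ^ x.2.2 j * ∑ b, channelTransition α β (x.1 j) b *
              (y ^ (if b then 1 else 0) * w b) := by
            rw [sum_jointTransition_mul_apply α β x.1 j fun b => y ^ (if b then 1 else 0) * w b]
        _ ≤ y ^ x.2.2 j * (Real.exp (-θ) * w (x.1 j)) :=
            mul_le_mul_of_nonneg_left (heig _) (pow_pos hy _).le
        _ = _ := by ring
    have h4 : ∑ a, jointTransition α β x.1 a *
        (Real.log B - 1 - D * blockCount x + S a (receivedCount x.2.2 a) * B⁻¹) =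
        (Real.log B - 1 - D * blockCount x) +
          (∑ a, jointTransition α β x.1 a * S a (receivedCount x.2.2 a)) * B⁻¹ := by
      simp only [mul_add, Finset.sum_add_distrib]
      rw [← Finset.sum_mul, sum_jointTransition, one_mul, Finset.sum_mul]
      congr 1
      exact Finset.sum_congr rfl fun a _ => by ring
    have h5 : (∑ a, jointTransition α β x.1 a * S a (receivedCount x.2.2 a)) * B⁻¹ ≤ 1 := by
      rw [← div_eq_mul_inv, div_le_one hBpos]
      exact h3
    have h6 : Real.log B = -θ + Real.log (S x.1 x.2.2) := by
      rw [hB, Real.log_mul (Real.exp_pos _).ne' (hS _ _).ne', Real.log_exp]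
    have h7 : V x = Real.log (S x.1 x.2.2) - D * blockCount x := rfl
    linarith
  have h0 : I (c, (0, fun _ => 0)) := ⟨i, hk⟩
  have h1 := stepOp_pow_le_of_drift h I hI V (-θ) hdrift t _ h0
  have h2 := stepOp_pow_le_of_invariant (k := k) h (fun _ => I) (fun _ => hI)
    ((fun _ => Real.log (y ^ k * min (w true) (w false))) -
      D • (blockCount : BroadcastState n → ℝ))
    V t 0 _ h0 (by
      rintro x ⟨j, hj⟩
      simp only [V, Pi.sub_apply]
      refine sub_le_sub_right ?_ _
      refine Real.log_le_log (mul_pos (pow_pos hy _) (lt_min (hw _) (hw _))) ?_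
      refine le_trans ?_ (hsingle x.1 x.2.2 j)
      refine mul_le_mul (pow_le_pow_of_le_one hy.le hy1 hj.le) ?_
        (lt_min (hw _) (hw _)).le (pow_pos hy _).le
      cases x.1 j
      · exact min_le_right _ _
      · exact min_le_left _ _)
  rw [map_sub, map_smul, stepOp_pow_const] at h2
  have h3 := hreset c
  have h4 : V (c, (0, fun _ => 0)) = Real.log (S c fun _ => 0) := by
    simp [V, Ψ, blockCount]
  rw [h4] at h1
  simp only [Pi.sub_apply, Pi.smul_apply, smul_eq_mul] at h2
  unfold expectedBlocks
  linarith

/-- A first block requires a packet at every user. A user without one stays so with probability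
`(1-β)^t` from OFF and at least `α (1-β)^t` from ON; independence gives the product. -/
theorem stepOp_pow_indicator_le (h : IsChannelParam α β) (hk : 0 < k) (t : ℕ) :
    ∀ x : BroadcastState n, (stepOp α β k ^ t) (fun y => if y.2.1 = 0 then 0 else 1) x ≤
      if x.2.1 = 0 then
        ∏ i, (1 - if x.2.2 i = 0 then (if x.1 i then α else 1) * (1 - β) ^ t else 0)
      else 1 := by
  obtain ⟨h1, h2, h3, h4, -⟩ := id h
  have hq : ∀ (t : ℕ) (b : Bool), (if b then α else 1) * (1 - β) ^ t ≤ 1 := by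
    intro t b
    refine mul_le_one₀ (by split_ifs <;> linarith) (pow_nonneg (by linarith) _)
      (pow_le_one₀ (by linarith) (by linarith))
  have hfac : ∀ (t : ℕ) (b : Bool) (m : ℕ),
      0 ≤ 1 - if m = 0 then (if b then α else 1) * (1 - β) ^ t else 0 := by
    intro t b m
    have := hq t b
    split_ifs at * <;> linarith
  induction t with
  | zero =>
    intro x
    simp only [pow_zero, Module.End.one_apply]
    split_ifs
    · refine Finset.prod_nonneg fun i _ => ?_
      simpa using hfac 0 (x.1 i) (x.2.2 i)
    · exact le_rfl
  | succ t ih =>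
    intro x
    rw [stepOp_pow_succ]
    refine (stepOp_le (G := fun x => if x.2.1 = 0 then
      ∏ i, (1 - if x.2.2 i = 0 then (if x.1 i then α else 1) * (1 - β) ^ t else 0) else 1)
      h fun a => ih _).trans ?_
    by_cases hm : x.2.1 = 0
    · rw [if_pos hm]
      have e1 : ∀ a : Fin n → Bool, (if (rlncUpdate k x.2 a).1 = 0 then
          ∏ i, (1 - if (rlncUpdate k x.2 a).2 i = 0 then
            (if a i then α else 1) * (1 - β) ^ t else 0) else 1) =
          ∏ i, (1 - if x.2.2 i + (if a i then 1 else 0) = 0 then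
            (if a i then α else 1) * (1 - β) ^ t else 0) := by
        intro a
        by_cases hc : ∀ i, k ≤ receivedCount x.2.2 a i
        · rw [rlncUpdate_of_complete hc, if_neg (by simp)]
          refine (Finset.prod_eq_one fun i _ => ?_).symm
          have : x.2.2 i + (if a i then 1 else 0) ≠ 0 := by
            have := hc i
            unfold receivedCount at this
            omega
          rw [if_neg this, sub_zero]
        · rw [rlncUpdate_of_not_complete hc, if_pos hm]
          rfl
      rw [stepOp_apply]
      simp only [e1]
      rw [sum_jointTransition_mul_prod α β x.1 fun i b =>
        1 - if x.2.2 i + (if b then 1 else 0) = 0 then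
          (if b then α else 1) * (1 - β) ^ t else 0]
      refine Finset.prod_le_prod (fun i _ => Finset.sum_nonneg fun b _ =>
        mul_nonneg (channelTransition_nonneg h _ _) (hfac _ _ _)) fun i _ => ?_
      have hp : 0 ≤ (1 - β) ^ t := pow_nonneg (by linarith) _
      by_cases hr : x.2.2 i = 0
      · cases x.1 i <;> simp [hr, channelTransition, pow_succ]
        · nlinarith
        · nlinarith [mul_nonneg (mul_nonneg h1.le hp) h3.le]
      · have : ∀ b : Bool, x.2.2 i + (if b then 1 else 0) ≠ 0 := fun b => by omega
        simp only [this, hr, if_false, sub_zero, mul_one, sum_channelTransition, le_refl]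
    · rw [if_neg hm]
      have e1 : ∀ a : Fin n → Bool, (rlncUpdate k x.2 a).1 ≠ 0 := fun a => by
        have := le_rlncUpdate_fst k x.2 a
        omega
      rw [stepOp_apply]
      simp only [e1, if_false, mul_one]
      rw [sum_jointTransition]

/-- At most `t` packets are delivered in `t` slots, and none unless some block is finished. -/
theorem mul_expectedBlocks_le_mul_exp (h : IsChannelParam α β) (hk : 0 < k) (i : Fin n) (t : ℕ)
    (c : Fin n → Bool) :
    k * expectedBlocks α β k t c ≤ t * Real.exp (-(n * (α * (1 - β) ^ t))) := by
  obtain ⟨h1, h2, h3, h4, -⟩ := id h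
  have e1 := stepOp_pow_le_of_invariant (k := k) h
    (fun s x => k * x.2.1 + x.2.2 i ≤ s) (fun s x a hx => by
      have := mul_rlncUpdate_add_le k x.2 a i
      have h5 : receivedCount x.2.2 a i ≤ x.2.2 i + 1 := by
        unfold receivedCount; split_ifs <;> omega
      change k * (rlncUpdate k x.2 a).1 + (rlncUpdate k x.2 a).2 i ≤ s + 1
      omega) ((k : ℝ) • blockCount) ((t : ℝ) • fun y => if y.2.1 = 0 then 0 else 1) t 0
    (c, (0, fun _ => 0)) (by simp) (fun x hx => by
      simp only [Pi.smul_apply, smul_eq_mul, blockCount]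
      split_ifs with hm
      · simp [hm]
      · rw [mul_one]
        have : k * x.2.1 ≤ t := by omega
        exact_mod_cast this)
  rw [map_smul, map_smul] at e1
  simp only [Pi.smul_apply, smul_eq_mul] at e1
  refine e1.trans (mul_le_mul_of_nonneg_left ?_ (Nat.cast_nonneg _))
  refine (stepOp_pow_indicator_le h hk t _).trans ?_
  simp only [if_true]
  have hp : 0 ≤ (1 - β) ^ t := pow_nonneg (by linarith) _
  have hp1 : (1 - β) ^ t ≤ 1 := pow_le_one₀ (by linarith) (by linarith)
  calc ∏ i, (1 - (if c i = true then α else 1) * (1 - β) ^ t)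
      ≤ ∏ _i : Fin n, Real.exp (-(α * (1 - β) ^ t)) := by
        refine Finset.prod_le_prod (fun i _ => ?_) fun i _ => ?_
        · have : (if c i = true then α else 1) ≤ 1 := by split_ifs <;> linarith
          nlinarith
        · have h5 := Real.one_sub_le_exp_neg (α * (1 - β) ^ t)
          have : α ≤ (if c i = true then α else 1) := by split_ifs <;> linarith
          nlinarith
    _ = _ := by
      rw [Finset.prod_const, Finset.card_univ, Fintype.card_fin, ← Real.exp_nat_mul]
      ring_nf

end

/-! ### Exponential moments of the interarrival time -/

/-- The moment generating function at `θ` of the time between two successive successful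
transmissions over one channel. -/
noncomputable def renewalMoment (α β θ : ℝ) : ℝ :=
  Real.exp θ * (1 - α + α * (β * Real.exp θ / (1 - Real.exp θ * (1 - β))))

section

variable {α β θ : ℝ}

theorem one_sub_erasureProb (h : IsChannelParam α β) :
    1 - erasureProb α β = β / (α + β) := by
  have : 0 < α + β := add_pos h.pos_left h.pos_right
  unfold erasureProb
  field_simp
  ring

/-- Jensen's inequality: `(α + β) / β` is the mean interarrival time. It is applied first to the
geometric OFF period, then to the choice of entering it. -/
theorem exp_le_renewalMoment (h : IsChannelParam α β) (hθ : Real.exp θ * (1 - β) < 1) :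
    Real.exp (θ * ((α + β) / β)) ≤ renewalMoment α β θ := by
  obtain ⟨h1, h2, h3, h4, -⟩ := h
  have hd : 0 < 1 - Real.exp θ * (1 - β) := by linarith
  have hZ : Real.exp (θ / β) ≤ β * Real.exp θ / (1 - Real.exp θ * (1 - β)) := by
    rw [le_div_iff₀ hd]
    have e1 : Real.exp (θ / β) * Real.exp (θ - θ / β) = Real.exp θ := by
      rw [← Real.exp_add]; ring_nf
    have e2 : 1 ≤ β * Real.exp (θ - θ / β) + (1 - β) * Real.exp θ := by
      have e3 := mul_le_mul_of_nonneg_left (Real.add_one_le_exp (θ - θ / β)) h3.le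
      have e4 := mul_le_mul_of_nonneg_left (Real.add_one_le_exp θ) (sub_nonneg.2 h4)
      have e5 : β * (θ - θ / β + 1) + (1 - β) * (θ + 1) = 1 := by field_simp; ring
      linarith
    nlinarith [Real.exp_pos (θ / β)]
  have hconv : Real.exp (α * (θ / β)) ≤ 1 - α + α * Real.exp (θ / β) := by
    have := convexOn_exp.2 (Set.mem_univ (0 : ℝ)) (Set.mem_univ (θ / β))
      (sub_nonneg.2 h2) h1.le (by ring)
    simpa using this
  have e : θ * ((α + β) / β) = θ + α * (θ / β) := by field_simp; ring
  rw [e, Real.exp_add]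
  refine mul_le_mul_of_nonneg_left (hconv.trans ?_) (Real.exp_pos _).le
  linarith [mul_le_mul_of_nonneg_left hZ h1.le]

theorem one_lt_renewalMoment (h : IsChannelParam α β) (hθ0 : 0 < θ)
    (hθ : Real.exp θ * (1 - β) < 1) : 1 < renewalMoment α β θ := by
  refine lt_of_lt_of_le ?_ (exp_le_renewalMoment h hθ)
  have := h.pos_left
  have := h.pos_right
  exact Real.one_lt_exp_iff.2 (by positivity)

theorem hasDerivAt_renewalMoment_zero (h : IsChannelParam α β) :
    HasDerivAt (renewalMoment α β) ((α + β) / β) 0 := by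
  have hβ := h.pos_right.ne'
  have e := Real.hasDerivAt_exp 0
  have hd : 1 - Real.exp 0 * (1 - β) ≠ 0 := by simpa using hβ
  have := e.mul (((((e.const_mul β).div ((e.mul_const (1 - β)).const_sub 1) hd).const_mul
    α).const_add (1 - α)))
  refine this.congr_deriv ?_
  simp only [Pi.div_apply, Real.exp_zero, one_mul, mul_one, sub_sub_cancel]
  field_simp
  ring

/-! ### Bounds on the block rate for fixed `n` and `k` -/

/-- Lower bound of the block rate, from the exponential moments of the interarrival times. -/
theorem exists_le_mul_block_rate (h : IsChannelParam α β) (hθ0 : 0 < θ)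
    (hθ : Real.exp θ * (1 - β) < 1) :
    ∃ c : ℝ, 0 ≤ c ∧ ∀ (n k : ℕ) (g : ℝ), 0 < n → 0 < k →
      Tendsto (fun t : ℕ => expectedBlocks α β k t (fun _ : Fin n => true) / t) atTop (𝓝 g) →
      θ ≤ (Real.log n + k * Real.log (renewalMoment α β θ) + c) * g := by
  have hβ := h.pos_right
  have hd : 0 < 1 - Real.exp θ * (1 - β) := by linarith
  have hz1 := one_lt_renewalMoment h hθ0 hθ
  set z := renewalMoment α β θ with hz
  have hz0 : 0 < z := by linarith
  -- The OFF row of the eigenvalue equation fixes the OFF weight, given weight 1 for ON; the ON row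
  -- then holds exactly because `y = z⁻¹`.
  let w : Bool → ℝ := fun b => if b then 1 else
    β * z⁻¹ * Real.exp θ / (1 - Real.exp θ * (1 - β))
  have hw : ∀ b, 0 < w b := by
    intro b
    cases b
    · simp only [w]
      norm_num
      positivity
    · simp [w]
  set W := max 1 (w false) with hWdef
  have hW1 : 1 ≤ W := le_max_left _ _
  have hW : ∀ b, w b ≤ W := by
    intro b
    cases b
    · exact le_max_right _ _
    · exact le_max_left _ _
  have heig : ∀ b, ∑ b', channelTransition α β b b' *
      (z⁻¹ ^ (if b' then 1 else 0) * w b') ≤ Real.exp (-θ) * w b := by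
    intro b
    refine le_of_eq ?_
    rw [Real.exp_neg]
    cases b <;> simp [channelTransition, w]
    · obtain ⟨d, hd'⟩ : ∃ d, d = 1 - Real.exp θ * (1 - β) := ⟨_, rfl⟩
      rw [← hd'] at hd ⊢
      field_simp
      linear_combination hd'
    · have e : 1 - α + α * (β * Real.exp θ / (1 - Real.exp θ * (1 - β))) =
          z * (Real.exp θ)⁻¹ := by
        rw [hz, renewalMoment]
        field_simp
      calc (1 - α) * z⁻¹ + α * (β * z⁻¹ * Real.exp θ / (1 - Real.exp θ * (1 - β)))
          = z⁻¹ * (1 - α + α * (β * Real.exp θ / (1 - Real.exp θ * (1 - β)))) := by ring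
        _ = (Real.exp θ)⁻¹ := by rw [e]; field_simp
  refine ⟨Real.log W, Real.log_nonneg hW1, fun n k g hn hk hg => ?_⟩
  have hD : Real.log (n * W) - Real.log (z⁻¹ ^ k * w true) =
      Real.log n + k * Real.log z + Real.log W := by
    have : w true = 1 := by simp [w]
    rw [this, mul_one, Real.log_pow, Real.log_inv, Real.log_mul (by positivity) (by positivity)]
    ring
  set κ := Real.log (z⁻¹ ^ k * min (w true) (w false)) - Real.log (n * W) with hκ
  have hle : ∀ t : ℕ, θ * t + κ ≤ (Real.log n + k * Real.log z + Real.log W) *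
      expectedBlocks α β k t (fun _ : Fin n => true) := by
    intro t
    rw [← hD]
    exact le_expectedBlocks_of_weight h hk ⟨0, hn⟩ (inv_pos.2 hz0) (inv_le_one_of_one_le₀ hz1.le)
      hw hW heig t _
  have hlim : Tendsto (fun t : ℕ => θ + κ / t) atTop (𝓝 (θ + 0)) :=
    tendsto_const_nhds.add (tendsto_const_div_atTop_nhds_zero_nat κ)
  rw [add_zero] at hlim
  refine le_of_tendsto_of_tendsto hlim (hg.const_mul _) ?_
  filter_upwards [eventually_gt_atTop 0] with t ht
  have ht : (0 : ℝ) < t := by exact_mod_cast ht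
  rw [← mul_div_assoc, le_div_iff₀ ht, add_mul, div_mul_cancel₀ _ ht.ne']
  exact hle t

theorem mul_block_rate_le (h : IsChannelParam α β) {n k : ℕ} {g : ℝ} (hn : 0 < n)
    (hg : Tendsto (fun t : ℕ => expectedBlocks α β k t (fun _ : Fin n => true) / t)
      atTop (𝓝 g)) : k * g ≤ 1 - erasureProb α β := by
  set κ := 2 * |(1 - α - β) / (α + β)| with hκ
  have hlim : Tendsto (fun t : ℕ => (1 - erasureProb α β) + κ / t) atTop
      (𝓝 ((1 - erasureProb α β) + 0)) :=
    tendsto_const_nhds.add (tendsto_const_div_atTop_nhds_zero_nat κ)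
  rw [add_zero] at hlim
  refine le_of_tendsto_of_tendsto (hg.const_mul _) hlim ?_
  filter_upwards [eventually_gt_atTop 0] with t ht
  have ht : (0 : ℝ) < t := by exact_mod_cast ht
  rw [← mul_div_assoc, div_le_iff₀ ht, add_mul, div_mul_cancel₀ _ ht.ne']
  exact mul_expectedBlocks_le h ⟨0, hn⟩ k t _

theorem block_rate_nonneg (h : IsChannelParam α β) {n k : ℕ} {g : ℝ}
    (hg : Tendsto (fun t : ℕ => expectedBlocks α β k t (fun _ : Fin n => true) / t)
      atTop (𝓝 g)) : 0 ≤ g :=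
  ge_of_tendsto' hg fun t => div_nonneg (expectedBlocks_nonneg h t _) (Nat.cast_nonneg _)

/-- Time is cut into windows of length `L`. Each contributes its own expected blocks plus at most
one straddling block, the source of `k / L`. -/
theorem mul_block_rate_le_exp_add (h : IsChannelParam α β) {n k L : ℕ} {g : ℝ} (hn : 0 < n)
    (hk : 0 < k) (hL : 0 < L)
    (hg : Tendsto (fun t : ℕ => expectedBlocks α β k t (fun _ : Fin n => true) / t)
      atTop (𝓝 g)) :
    k * g ≤ Real.exp (-(n * (α * (1 - β) ^ L))) + k / L := by
  have hk' : (0 : ℝ) < k := by exact_mod_cast hk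
  have hL' : (0 : ℝ) < L := by exact_mod_cast hL
  set E := Real.exp (-(n * (α * (1 - β) ^ L))) with hE
  have hu : ∀ a : Fin n → Bool, expectedBlocks α β k L a ≤ L * E / k := fun a => by
    rw [le_div_iff₀ hk', mul_comm]
    exact mul_expectedBlocks_le_mul_exp h hk ⟨0, hn⟩ L a
  have hmul : ∀ j : ℕ, expectedBlocks α β k (j * L) (fun _ : Fin n => true) ≤
      j * (L * E / k + 1) := by
    intro j
    induction j with
    | zero => simp [expectedBlocks, blockCount]
    | succ j ih =>
      rw [Nat.succ_mul]
      have := expectedBlocks_add_le_of_le h (j * L) L (fun _ : Fin n => true) hu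
      push_cast
      linarith
  have hlim := hg.comp (tendsto_id.atTop_mul_const' hL)
  have hgle : g ≤ (L * E / k + 1) / L := by
    refine le_of_tendsto hlim ?_
    filter_upwards [eventually_gt_atTop 0] with j hj
    have hj' : (0 : ℝ) < j := by exact_mod_cast hj
    simp only [Function.comp, id]
    push_cast
    rw [div_le_div_iff₀ (by positivity) hL']
    have := mul_le_mul_of_nonneg_right (hmul j) hL'.le
    linarith
  calc k * g ≤ k * ((L * E / k + 1) / L) := mul_le_mul_of_nonneg_left hgle hk'.le
    _ = E + k / L := by field_simp

/-! ### Asymptotics in the number of users -/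

theorem tendsto_zero_of_isLittleO_log (h : IsChannelParam α β) (hβ : β < 1) {η : ℕ → ℝ}
    {k : ℕ → ℕ} (hη0 : ∀ n, 0 < n → 0 ≤ η n)
    (hη : ∀ n L : ℕ, 0 < n → 0 < L →
      η n ≤ Real.exp (-(n * (α * (1 - β) ^ L))) + k n / L)
    (hk : (fun n => (k n : ℝ)) =o[atTop] (fun n : ℕ => Real.log n)) :
    Tendsto η atTop (𝓝 0) := by
  have hα := h.pos_left
  have hβ0 := h.pos_right
  have hlog : Tendsto (fun n : ℕ => Real.log n) atTop atTop :=
    Real.tendsto_log_atTop.comp tendsto_natCast_atTop_atTop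
  set l := -Real.log (1 - β) with hl
  have hl0 : 0 < l := neg_pos.2 (Real.log_neg (by linarith) (by linarith))
  -- With `L ≤ a * log n` one has `(1-β)^L ≥ n^(-1/2)`, so the exponent is at least `α √n`, while
  -- `L` still dominates `k`.
  set a := 1 / (2 * l) with ha
  have ha0 : 0 < a := by positivity
  let L : ℕ → ℕ := fun n => ⌊a * Real.log n⌋₊
  have hLdiv : Tendsto (fun n => (L n : ℝ) / Real.log n) atTop (𝓝 a) :=
    (tendsto_nat_floor_mul_div_atTop ha0.le).comp hlog
  have hLpos : ∀ᶠ n in atTop, 0 < L n :=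
    (tendsto_nat_floor_atTop.comp (hlog.const_mul_atTop ha0)).eventually_gt_atTop 0
  have h2 : Tendsto (fun n => (k n : ℝ) / L n) atTop (𝓝 0) := by
    have := hk.tendsto_div_nhds_zero.div hLdiv ha0.ne'
    rw [zero_div] at this
    refine this.congr' ?_
    filter_upwards [hlog.eventually_gt_atTop 0] with n hn
    simp only [Pi.div_apply]
    exact div_div_div_cancel_right₀ hn.ne' _ _
  have h1 : Tendsto (fun n : ℕ => Real.exp (-(α * Real.exp (Real.log n / 2)))) atTop (𝓝 0) :=
    Real.tendsto_exp_neg_atTop_nhds_zero.comp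
      ((Real.tendsto_exp_atTop.comp (hlog.atTop_div_const two_pos)).const_mul_atTop hα)
  have h3 := h1.add h2
  rw [add_zero] at h3
  refine squeeze_zero' ?_ ?_ h3
  · filter_upwards [eventually_gt_atTop 0] with n hn using hη0 n hn
  · filter_upwards [eventually_gt_atTop 0, hLpos, hlog.eventually_gt_atTop 0] with n hn hL hln
    refine (hη n (L n) hn hL).trans (add_le_add_left (Real.exp_le_exp.2 (neg_le_neg ?_)) _)
    have hn' : (0 : ℝ) < n := by exact_mod_cast hn
    have e1 : (L n : ℝ) ≤ a * Real.log n := Nat.floor_le (by positivity)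
    have e2 : (1 - β) ^ L n = Real.exp (-(l * L n)) := by
      nth_rewrite 1 [← Real.exp_log (show 0 < 1 - β by linarith)]
      rw [← Real.exp_nat_mul, hl]
      ring_nf
    have e3 : Real.exp (-(Real.log n / 2)) ≤ (1 - β) ^ L n := by
      rw [e2, Real.exp_le_exp, neg_le_neg_iff]
      calc l * L n ≤ l * (a * Real.log n) := mul_le_mul_of_nonneg_left e1 hl0.le
        _ = Real.log n / 2 := by rw [ha]; field_simp
    have e4 : (n : ℝ) * Real.exp (-(Real.log n / 2)) = Real.exp (Real.log n / 2) := by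
      nth_rewrite 1 [← Real.exp_log hn']
      rw [← Real.exp_add]
      ring_nf
    calc α * Real.exp (Real.log n / 2) = n * (α * Real.exp (-(Real.log n / 2))) := by
          rw [← e4]; ring
      _ ≤ _ := by gcongr

theorem tendsto_natCast_atTop_of_le_div_log {k : ℕ → ℕ} {b : ℝ} (hb : 0 < b)
    (hk : ∀ᶠ n : ℕ in atTop, b ≤ (k n : ℝ) / Real.log n) :
    Tendsto (fun n => (k n : ℝ)) atTop atTop := by
  have hlog : Tendsto (fun n : ℕ => Real.log n) atTop atTop :=
    Real.tendsto_log_atTop.comp tendsto_natCast_atTop_atTop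
  refine tendsto_atTop_mono' _ ?_ (hlog.const_mul_atTop hb)
  filter_upwards [hk, hlog.eventually_gt_atTop 0] with n h1 h2
  rwa [le_div_iff₀ h2] at h1

/-- Near zero `z - 1` is about `θ (α + β) / β`, the derivative being the mean interarrival time, and
`log z ≤ z - 1`. -/
theorem exists_mul_log_renewalMoment_lt (h : IsChannelParam α β) {v : ℝ} (hv0 : 0 ≤ v)
    (hv : v < β / (α + β)) :
    ∃ θ : ℝ, 0 < θ ∧ Real.exp θ * (1 - β) < 1 ∧ v * Real.log (renewalMoment α β θ) < θ := by
  have hβ := h.pos_right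
  have hs : 0 < α + β := add_pos h.pos_left hβ
  have h0 : renewalMoment α β 0 = 1 := by
    simp [renewalMoment, hβ.ne']
  have hd := (hasDerivAt_renewalMoment_zero h).tendsto_slope_zero_right
  have h1 : Tendsto (fun θ : ℝ => v * (θ⁻¹ • (renewalMoment α β (0 + θ) - renewalMoment α β 0)))
      (𝓝[>] 0) (𝓝 (v * ((α + β) / β))) := hd.const_mul v
  have h2 : v * ((α + β) / β) < 1 := by
    rw [lt_div_iff₀ hs] at hv
    rw [← mul_div_assoc, div_lt_one hβ]
    exact hv
  have h3 : Tendsto (fun θ : ℝ => Real.exp θ * (1 - β)) (𝓝[>] 0) (𝓝 (Real.exp 0 * (1 - β))) :=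
    ((Real.continuous_exp.mul continuous_const).tendsto 0).mono_left nhdsWithin_le_nhds
  have h4 : Real.exp 0 * (1 - β) < 1 := by rw [Real.exp_zero]; linarith
  obtain ⟨θ, e1, e2, e3⟩ := ((h1.eventually_lt_const h2).and
    ((h3.eventually_lt_const h4).and self_mem_nhdsWithin)).exists
  have hθ : 0 < θ := e3
  refine ⟨θ, hθ, e2, ?_⟩
  have hz := one_lt_renewalMoment h hθ e2
  rw [zero_add, h0, smul_eq_mul] at e1
  calc v * Real.log (renewalMoment α β θ) ≤ v * (renewalMoment α β θ - 1) :=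
        mul_le_mul_of_nonneg_left (Real.log_le_sub_one_of_pos (by linarith)) hv0
    _ = v * (θ⁻¹ * (renewalMoment α β θ - 1)) * θ := by field_simp
    _ < 1 * θ := mul_lt_mul_of_pos_right e1 hθ
    _ = θ := one_mul θ

theorem tendsto_capacity_of_tendsto_atTop (h : IsChannelParam α β) {η : ℕ → ℝ}
    {k : ℕ → ℕ} (hη0 : ∀ n, 0 < n → 0 ≤ η n) (hη1 : ∀ n, 0 < n → η n ≤ 1 - erasureProb α β)
    (hη : ∀ θ : ℝ, 0 < θ → Real.exp θ * (1 - β) < 1 → ∃ c : ℝ, 0 ≤ c ∧ ∀ n : ℕ, 0 < n →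
      k n * θ ≤ (Real.log n + k n * Real.log (renewalMoment α β θ) + c) * η n)
    (hk : Tendsto (fun n : ℕ => (k n : ℝ) / Real.log n) atTop atTop) :
    Tendsto η atTop (𝓝 (1 - erasureProb α β)) := by
  refine tendsto_order.2 ⟨fun v hv => ?_, fun v hv => ?_⟩
  · rcases lt_or_ge v 0 with hv0 | hv0
    · filter_upwards [eventually_gt_atTop 0] with n hn using hv0.trans_le (hη0 n hn)
    rw [one_sub_erasureProb h] at hv
    obtain ⟨θ, hθ0, hθ1, hθ2⟩ := exists_mul_log_renewalMoment_lt h hv0 hv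
    obtain ⟨c, hc0, hc⟩ := hη θ hθ0 hθ1
    have hz := Real.log_pos (one_lt_renewalMoment h hθ0 hθ1)
    have hkt := tendsto_natCast_atTop_of_le_div_log one_pos (hk.eventually_ge_atTop 1)
    have h1 : Tendsto (fun n : ℕ => v * (((k n : ℝ) / Real.log n)⁻¹ + c / k n)) atTop
        (𝓝 (v * (0 + 0))) :=
      ((tendsto_inv_atTop_zero.comp hk).add (tendsto_const_nhds.div_atTop hkt)).const_mul v
    rw [add_zero, mul_zero] at h1
    filter_upwards [h1.eventually_lt_const (sub_pos.2 hθ2), eventually_gt_atTop 0,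
      hkt.eventually_gt_atTop 0] with n e1 e2 e3
    by_contra hle
    rw [not_lt] at hle
    have hlog : 0 ≤ Real.log n := Real.log_natCast_nonneg n
    have e4 := (hc n e2).trans (mul_le_mul_of_nonneg_left hle (by positivity))
    rw [inv_div, ← add_div, ← mul_div_assoc, div_lt_iff₀ e3] at e1
    nlinarith
  · filter_upwards [eventually_gt_atTop 0] with n hn using (hη1 n hn).trans_lt hv

/-! ### The constant `r` and the lower bound for logarithmic block sizes -/

theorem tiltedMoment_eq (h : IsChannelParam α β) {bhat b : ℝ}
    (hθ : Real.exp (tiltExponent α β bhat b) * (1 - β) < 1) :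
    tiltedMoment α β bhat b =
      Real.exp (-(tiltExponent α β bhat b * ((α + β) / β))) *
        renewalMoment α β (tiltExponent α β bhat b) := by
  have hα := h.pos_left
  have hβ := h.pos_right
  have e1 : -(b * Real.sqrt α) / Real.sqrt (2 - α - β) / Real.sqrt bhat =
      -(tiltExponent α β bhat b * ((α + β) / β)) + tiltExponent α β bhat b := by
    have e2 : tiltExponent α β bhat b =
        b * β / (Real.sqrt α * Real.sqrt (2 - α - β)) / Real.sqrt bhat := by
      rw [tiltExponent, Real.sqrt_mul hα.le]
    have hsα : Real.sqrt α ≠ 0 := (Real.sqrt_pos.2 hα).ne'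
    have e3 : -(tiltExponent α β bhat b * ((α + β) / β)) + tiltExponent α β bhat b =
        -(tiltExponent α β bhat b * (α / β)) := by field_simp; ring
    have e4 : α / Real.sqrt α = Real.sqrt α := Real.div_sqrt
    rw [e3, e2]
    calc -(b * Real.sqrt α) / Real.sqrt (2 - α - β) / Real.sqrt bhat
        = -(b * (α / Real.sqrt α)) / Real.sqrt (2 - α - β) / Real.sqrt bhat := by rw [e4]
      _ = -(b * (β * β⁻¹) * (α / Real.sqrt α)) / Real.sqrt (2 - α - β) / Real.sqrt bhat := by
        rw [mul_inv_cancel₀ hβ.ne', mul_one]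
      _ = _ := by
        simp only [div_eq_mul_inv, mul_inv]
        ring
  rw [tiltedMoment, e1, Real.exp_add, renewalMoment]
  set x := tiltExponent α β bhat b
  have hd : 1 - Real.exp x * (1 - β) ≠ 0 := by linarith
  field_simp
  ring

theorem capacityFraction_eq (h : IsChannelParam α β) {bhat b τ₀ : ℝ} (hbhat : 0 < bhat)
    (hb : 0 < b) :
    0 < tiltExponent α β bhat b ∧ capacityFraction α β bhat b τ₀ =
      (1 + (1 - erasureProb α β) / (τ₀ * bhat) +
        (1 - erasureProb α β) / (tiltExponent α β bhat b * bhat) *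
          (1 + bhat * Real.log (tiltedMoment α β bhat b)))⁻¹ := by
  have hα := h.pos_left
  have hβ := h.pos_right
  have h2 : 0 < 2 - α - β := by
    have h3 : α + β ≤ 2 := by linarith [h.left_le_one, h.right_le_one]
    linarith [lt_of_le_of_ne h3 h.ne_two]
  have hA : 0 < Real.sqrt (α * (2 - α - β)) := Real.sqrt_pos.2 (mul_pos hα h2)
  have hB : 0 < Real.sqrt bhat := Real.sqrt_pos.2 hbhat
  refine ⟨div_pos (div_pos (mul_pos hb hβ) hA) hB, ?_⟩
  have e : tiltExponent α β bhat b * bhat =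
      b * β * Real.sqrt bhat / Real.sqrt (α * (2 - α - β)) := by
    rw [tiltExponent]
    nth_rewrite 2 [← Real.mul_self_sqrt hbhat.le]
    field_simp
  rw [e, capacityFraction, div_div_eq_mul_div]

/-- Jensen's inequality gives `log ρ ≥ 0`, hence `r < 1`. The last identity writes `r (1 - p)` as `θ
/ (log z + 1 / bhat + θ / (τ₀ * bhat))`, the form comparable with the drift bound. -/
theorem capacityFraction_spec (h : IsChannelParam α β) {bhat b τ₀ : ℝ} (hbhat : 0 < bhat)
    (hb : 0 < b) (hθ : Real.exp (tiltExponent α β bhat b) * (1 - β) < 1) (hτ : 0 < τ₀) :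
    0 < capacityFraction α β bhat b τ₀ ∧ capacityFraction α β bhat b τ₀ < 1 ∧
      capacityFraction α β bhat b τ₀ * (1 - erasureProb α β) *
        (Real.log (renewalMoment α β (tiltExponent α β bhat b)) +
          (1 / bhat + tiltExponent α β bhat b / (τ₀ * bhat))) = tiltExponent α β bhat b := by
  have hα := h.pos_left
  have hβ := h.pos_right
  obtain ⟨hθ0, hr⟩ := capacityFraction_eq (τ₀ := τ₀) h hbhat hb
  set θ := tiltExponent α β bhat b with hθdef
  have hz := one_lt_renewalMoment h hθ0 hθ
  have hzle := exp_le_renewalMoment h hθ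
  have hlogz : θ * ((α + β) / β) ≤ Real.log (renewalMoment α β θ) :=
    (Real.le_log_iff_exp_le (by linarith)).2 hzle
  have hρ : Real.log (tiltedMoment α β bhat b) =
      Real.log (renewalMoment α β θ) - θ * ((α + β) / β) := by
    rw [tiltedMoment_eq h hθ, Real.log_mul (Real.exp_pos _).ne' (by linarith), Real.log_exp]
    ring
  rw [hρ, one_sub_erasureProb h] at hr
  rw [one_sub_erasureProb h]
  set q := Real.log (renewalMoment α β θ)
  have hs : 0 < β / (α + β) := by positivity
  have h1 : 0 < β / (α + β) / (τ₀ * bhat) := by positivity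
  have h2 : 0 ≤ β / (α + β) / (θ * bhat) * (1 + bhat * (q - θ * ((α + β) / β))) := by
    have : 0 ≤ q - θ * ((α + β) / β) := sub_nonneg.2 hlogz
    positivity
  set X := 1 + β / (α + β) / (τ₀ * bhat) +
    β / (α + β) / (θ * bhat) * (1 + bhat * (q - θ * ((α + β) / β))) with hX
  have hX1 : 1 < X := by linarith
  refine ⟨hr ▸ inv_pos.2 (by linarith), hr ▸ inv_lt_one_of_one_lt₀ hX1, ?_⟩
  have e : β / (α + β) * (q + (1 / bhat + θ / (τ₀ * bhat))) = θ * X := by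
    rw [hX]
    have : α + β ≠ 0 := by positivity
    field_simp
    ring
  rw [hr, mul_assoc, e]
  field_simp

theorem capacityFraction_mul_le_liminf (h : IsChannelParam α β) {η : ℕ → ℝ} {k : ℕ → ℕ}
    (hη1 : ∀ n, 0 < n → η n ≤ 1 - erasureProb α β)
    (hη : ∀ θ : ℝ, 0 < θ → Real.exp θ * (1 - β) < 1 → ∃ c : ℝ, 0 ≤ c ∧ ∀ n : ℕ, 0 < n →
      k n * θ ≤ (Real.log n + k n * Real.log (renewalMoment α β θ) + c) * η n)
    {bhat b τ₀ : ℝ} (hbhat : 0 < bhat)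
    (hk : bhat ≤ liminf (fun n : ℕ => (k n : ℝ) / Real.log n) atTop) (hb : 0 < b)
    (hθ : Real.exp (tiltExponent α β bhat b) * (1 - β) < 1) (hτ : 0 < τ₀) :
    capacityFraction α β bhat b τ₀ * (1 - erasureProb α β) ≤ liminf η atTop := by
  obtain ⟨hr0, -, hr⟩ := capacityFraction_spec h hbhat hb hθ hτ
  have hθ0 := (capacityFraction_eq (τ₀ := τ₀) h hbhat hb).1
  set θ := tiltExponent α β bhat b
  set R := capacityFraction α β bhat b τ₀ * (1 - erasureProb α β)
  have hR : 0 < R := mul_pos hr0 (by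
    rw [one_sub_erasureProb h]
    exact div_pos h.pos_right (add_pos h.pos_left h.pos_right))
  obtain ⟨c, hc0, hc⟩ := hη θ hθ0 hθ
  have hz := Real.log_pos (one_lt_renewalMoment h hθ0 hθ)
  set q := Real.log (renewalMoment α β θ)
  -- Half of the slack `θ / (τ₀ * bhat)` pays for `log n / k` exceeding `1 / bhat`, the other half
  -- for `c / k`.
  set b' := (1 / bhat + θ / (τ₀ * bhat) / 2)⁻¹ with hb'
  have hpos : 0 < θ / (τ₀ * bhat) := by positivity
  have hb'0 : 0 < b' := by positivity
  have hb'lt : b' < bhat := by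
    rw [hb']
    refine inv_lt_of_inv_lt₀ hbhat ?_
    rw [← one_div]
    linarith
  have hev : ∀ᶠ n : ℕ in atTop, b' < (k n : ℝ) / Real.log n :=
    eventually_lt_of_lt_liminf (hb'lt.trans_le hk) (isBoundedUnder_of_eventually_ge (a := 0)
      (Eventually.of_forall fun n => div_nonneg (Nat.cast_nonneg _) (Real.log_natCast_nonneg n)))
  have hkt := tendsto_natCast_atTop_of_le_div_log hb'0 (hev.mono fun _ => le_of_lt)
  have hck : Tendsto (fun n => c / (k n : ℝ)) atTop (𝓝 0) := tendsto_const_nhds.div_atTop hkt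
  have hcob : IsCoboundedUnder (· ≥ ·) atTop η :=
    (isBoundedUnder_of_eventually_le (a := 1 - erasureProb α β) (by
      filter_upwards [eventually_gt_atTop 0] with n hn using hη1 n hn)).isCoboundedUnder_ge
  refine le_liminf_of_le hcob ?_
  have hlog : Tendsto (fun n : ℕ => Real.log n) atTop atTop :=
    Real.tendsto_log_atTop.comp tendsto_natCast_atTop_atTop
  filter_upwards [hev, hkt.eventually_gt_atTop 0, eventually_gt_atTop 0,
    hck.eventually_lt_const (half_pos hpos), hlog.eventually_gt_atTop 0] with n e1 e2 e3 e4 e5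
  have e6 : Real.log n / k n < 1 / bhat + θ / (τ₀ * bhat) / 2 := by
    have := inv_strictAnti₀ hb'0 e1
    rwa [inv_div, hb', inv_inv] at this
  have e7 : Real.log n + k n * q + c ≤ k n * (q + (1 / bhat + θ / (τ₀ * bhat))) := by
    have e8 : Real.log n + k n * q + c = k n * (q + (Real.log n / k n + c / k n)) := by
      field_simp
      ring
    rw [e8]
    exact mul_le_mul_of_nonneg_left (by linarith) e2.le
  have e9 : (Real.log n + k n * q + c) * R ≤ (Real.log n + k n * q + c) * η n :=
    calc (Real.log n + k n * q + c) * R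
        ≤ k n * (q + (1 / bhat + θ / (τ₀ * bhat))) * R :=
          mul_le_mul_of_nonneg_right e7 hR.le
      _ = k n * (R * (q + (1 / bhat + θ / (τ₀ * bhat)))) := by ring
      _ = k n * θ := by rw [hr]
      _ ≤ _ := hc n e3
  exact le_of_mul_le_mul_left e9 (by positivity)

end

theorem theorem1 (α β : ℝ) (hα : 0 < α) (hα1 : α ≤ 1) (hβ : 0 < β) (hβ1 : β ≤ 1)
    (hαβ : α + β ≠ 2)
    {Ω : ℕ → Type*} [∀ n, MeasurableSpace (Ω n)]
    (P : ∀ n, Measure (Ω n)) [∀ n, IsProbabilityMeasure (P n)]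
    (C : ∀ n, Fin n → ℕ → Ω n → Bool)
    (hC : ∀ n, IsErasureChannelSystem α β (P n) (C n)) :
    ∃ η : ℕ → ℕ → ℝ,
      (∀ n k : ℕ, 0 < n → 0 < k → IsThroughput (P n) (C n) k (η n k)) ∧
      ∀ k : ℕ → ℕ, (∀ n, 0 < k n) →
        (β < 1 → (fun n => (k n : ℝ)) =o[atTop] (fun n : ℕ => Real.log n) →
          Tendsto (fun n => η n (k n)) atTop (𝓝 0)) ∧
        (Tendsto (fun n : ℕ => (k n : ℝ) / Real.log n) atTop atTop →
          Tendsto (fun n => η n (k n)) atTop (𝓝 (1 - erasureProb α β))) ∧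
        ((fun n => (k n : ℝ)) =Θ[atTop] (fun n : ℕ => Real.log n) →
          ∀ bhat b τ₀ : ℝ, 0 < bhat →
            bhat ≤ liminf (fun n : ℕ => (k n : ℝ) / Real.log n) atTop →
            0 < b → Real.exp (tiltExponent α β bhat b) * (1 - β) < 1 →
            0 < τ₀ → Real.exp τ₀ * (1 - β) < 1 →
            0 < capacityFraction α β bhat b τ₀ ∧ capacityFraction α β bhat b τ₀ < 1 ∧
              capacityFraction α β bhat b τ₀ * (1 - erasureProb α β) ≤
                liminf (fun n => η n (k n)) atTop) := by
  have h : IsChannelParam α β := ⟨hα, hα1, hβ, hβ1, hαβ⟩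
  choose g hg using fun n k => exists_tendsto_expectedBlocks_div h n k
  refine ⟨fun n k => k * g n k, fun n k _ _ => (hC n).isThroughput h k (hg n k),
    fun k hk => ?_⟩
  have hη0 : ∀ n, 0 < n → 0 ≤ k n * g n (k n) := fun n _ =>
    mul_nonneg (Nat.cast_nonneg _) (block_rate_nonneg h (hg n (k n)))
  have hη1 : ∀ n, 0 < n → k n * g n (k n) ≤ 1 - erasureProb α β := fun n hn =>
    mul_block_rate_le h hn (hg n (k n))
  have hη : ∀ θ : ℝ, 0 < θ → Real.exp θ * (1 - β) < 1 → ∃ c : ℝ, 0 ≤ c ∧ ∀ n : ℕ, 0 < n →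
      k n * θ ≤ (Real.log n + k n * Real.log (renewalMoment α β θ) + c) *
        (k n * g n (k n)) := by
    intro θ hθ0 hθ
    obtain ⟨c, hc0, hc⟩ := exists_le_mul_block_rate h hθ0 hθ
    refine ⟨c, hc0, fun n hn => ?_⟩
    have := mul_le_mul_of_nonneg_left (hc n (k n) _ hn (hk n) (hg n (k n)))
      (Nat.cast_nonneg (α := ℝ) (k n))
    linarith
  refine ⟨fun hβ' hko => ?_, fun hkω => ?_, fun _ bhat b τ₀ hbhat hkb hb hθ hτ _ => ?_⟩
  · exact tendsto_zero_of_isLittleO_log h hβ' hη0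
      (fun n L hn hL => mul_block_rate_le_exp_add h hn (hk n) hL (hg n (k n))) hko
  · exact tendsto_capacity_of_tendsto_atTop h hη0 hη1 hη hkω
  · obtain ⟨h1, h2, -⟩ := capacityFraction_spec h hbhat hb hθ hτ
    exact ⟨h1, h2, capacityFraction_mul_le_liminf h hη1 hη hbhat hkb hb hθ hτ⟩
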